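/- Let $n\ge d\ge 1$ be integers, let $L=\{\ell_1,\dots,\ell_n\}$ and $R=\{r_1,\dots,r_d\}$. All graphs are bipartite graphs on $L\sqcup R$, identified with their edge sets. A \emph{tope} of type $v=(v_1,\dots,v_d)\in\mathbb Z_{>0}^d$ on $\sigma\subseteq L$ is a graph with right degree vector $v$ whose left degree vector is the characteristic vector of $\sigma$ (so $|\sigma|=\sum_i v_i$). A \emph{tope field} of type $v$ and thickness $k=\sum_i v_i\le n$ is a set of topes of type $v$ containing exactly one tope $M_\sigma$ on each $k$-subset $\sigma\subseteq L$; an \emph{$(n,d)$-matching field} is a tope field of type $(1,\dots,1)$. A matching field $(M_\sigma)$ is \emph{linkage} if for every $r_i\in R$ and every $(d+1)$-subset $\tau\subseteq L$ there are distinct $\ell_j,\ell_{j'}\in\tau$ such that $M_{\tau\setminus\{\ell_j\}}$ and $M_{\tau\setminus\{\ell_{j'}\}}$ agree everywhere other than on $r_i$. For a tope field of type $v$ and thickness $k$, its \emph{$i$-amalgamation} is the set of all topes of type $v+e_i$ on $(k+1)$-subsets $\tau\subseteq L$ that are contained in the union of the topes $M_\sigma$ with $\sigma\subset\tau$, $|\sigma|=k$.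 The \emph{maximal topes} of a linkage matching field are the topes of thickness $n$ obtained from it by sequences of $i$-amalgamations (with $i\in[d]$ arbitrary in each step, and no step if $n=d$). Two graphs are \emph{compatible} if, whenever both contain a perfect matching on the same node set $J\sqcup I$ with $J\subseteq L$, $I\subseteq R$, these perfect matchings are equal. An \emph{$(n,d)$-tope arrangement} is a set of pairwise compatible topes such that sending a tope with right degree vector $v$ to $v-(1,\dots,1)$ is a bijection from this set to the set of lattice points of the dilated simplex $(n-d)\Delta_{d-1}$, i.e. $\{w\in\mathbb Z_{\ge 0}^d : \sum_i w_i=n-d\}$. The \emph{maximal matchings} in a tope arrangement are the inclusion-maximal matchings contained in its topes. \textbf{Theorem.} Linkage $(n,d)$-matching fields and $(n,d)$-tope arrangements are cryptomorphic. Explicitly: \begin{enumerate} \item the maximal topes of a linkage $(n,d)$-matching field form an $(n,d)$-tope arrangement; \item the set of all maximal matchings in an $(n,d)$-tope arrangement is a linkage $(n,d)$-matching field; \item these two constructions are mutually inverse: every linkage $(n,d)$-matching field is the set of maximal matchings in the tope arrangement of its maximal topes, and every $(n,d)$-tope arrangement is the set of maximal topes of the linkage matching field of its maximal matchings. \end{enumerate}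 -/

import Mathlib

namespace TopeArr

open Finset

/-- A bipartite graph with left nodes `ℓ_1, …, ℓ_n` (here `Fin n`) and right nodes `r_1, …, r_d`
(here `Fin d`), identified with its set of edges `(ℓ_j, r_i)`. -/
abbrev BipGraph (n d : ℕ) : Type := Finset (Fin n × Fin d)

variable {n d : ℕ}

/-- The left degree vector. -/
def leftDeg (G : BipGraph n d) (j : Fin n) : ℕ := #{e ∈ G | e.1 = j}

/-- The right degree vector. -/
def rightDeg (G : BipGraph n d) (i : Fin d) : ℕ := #{e ∈ G | e.2 = i}

/-- The characteristic vector of a set of left nodes. -/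
def charVec (σ : Finset (Fin n)) (j : Fin n) : ℕ := if j ∈ σ then 1 else 0

/-- `G` is a tope of type `v` (a vector of positive integers) on the set `σ` of left nodes. -/
def IsTope (v : Fin d → ℕ) (σ : Finset (Fin n)) (G : BipGraph n d) : Prop :=
  (∀ i, 0 < v i) ∧ rightDeg G = v ∧ leftDeg G = charVec σ

/-- `𝓜` is a tope field of type `v`: a set consisting of exactly one tope of type `v` on each
`k`-subset of the left nodes, where `k = ∑ v_i ≤ n` is the thickness. -/
def IsTopeField (v : Fin d → ℕ) (𝓜 : Set (BipGraph n d)) : Prop :=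
  (∀ i, 0 < v i) ∧ ∑ i, v i ≤ n ∧
  (∀ G ∈ 𝓜, ∃ σ : Finset (Fin n), #σ = ∑ i, v i ∧ IsTope v σ G) ∧
  ∀ σ : Finset (Fin n), #σ = ∑ i, v i → ∃! G, G ∈ 𝓜 ∧ IsTope v σ G

/-- A matching field: a tope field of type `(1, …, 1)`. -/
def IsMatchingField (𝓜 : Set (BipGraph n d)) : Prop := IsTopeField 1 𝓜

/-- The linkage axiom: for every right node `r` and every `(d+1)`-set `τ` of left nodes there are
distinct `a, b ∈ τ` such that the members of `𝓜` on `τ \ {a}` and on `τ \ {b}` agree everywhere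
other than on `r`. -/
def LinkageAxiom (𝓜 : Set (BipGraph n d)) : Prop :=
  ∀ (r : Fin d) (τ : Finset (Fin n)), #τ = d + 1 →
    ∃ a ∈ τ, ∃ b ∈ τ, a ≠ b ∧ ∃ A ∈ 𝓜, ∃ B ∈ 𝓜,
      leftDeg A = charVec (τ.erase a) ∧ leftDeg B = charVec (τ.erase b) ∧
      ∀ (j : Fin n) (i : Fin d), i ≠ r → ((j, i) ∈ A ↔ (j, i) ∈ B)

/-- A linkage matching field. -/
def IsLinkageMatchingField (𝓜 : Set (BipGraph n d)) : Prop :=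
  IsMatchingField 𝓜 ∧ LinkageAxiom 𝓜

/-- `P` is a perfect matching on the node set `J ⊔ I`. -/
def IsPerfectMatchingOn (J : Finset (Fin n)) (I : Finset (Fin d)) (P : BipGraph n d) : Prop :=
  (∀ e ∈ P, e.1 ∈ J ∧ e.2 ∈ I) ∧ (∀ j ∈ J, leftDeg P j = 1) ∧ (∀ i ∈ I, rightDeg P i = 1)

/-- Two graphs are compatible if, whenever both contain a perfect matching on the same node set
`J ⊔ I`, these perfect matchings are equal. -/
def Compatible (F₁ F₂ : BipGraph n d) : Prop :=
  ∀ (J : Finset (Fin n)) (I : Finset (Fin d)) (P₁ P₂ : BipGraph n d),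
    P₁ ⊆ F₁ → P₂ ⊆ F₂ → IsPerfectMatchingOn J I P₁ → IsPerfectMatchingOn J I P₂ → P₁ = P₂

/-- The lattice points of the dilated simplex `kΔ_{d-1}`. -/
def simplexPoints (k d : ℕ) : Set (Fin d → ℕ) := {w | ∑ i, w i = k}

/-- An `(n,d)`-tope arrangement: a set of pairwise compatible topes such that sending a tope with
right degree vector `v` to `v - (1, …, 1)` is a bijection onto the lattice points of
`(n-d)Δ_{d-1}`.  (Right degrees of topes are positive, so the subtraction is not truncated.) -/
def IsTopeArrangement (𝓣 : Set (BipGraph n d)) : Prop :=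
  (∀ T ∈ 𝓣, ∃ v σ, IsTope v σ T) ∧
  (∀ T₁ ∈ 𝓣, ∀ T₂ ∈ 𝓣, Compatible T₁ T₂) ∧
  Set.BijOn (fun T i => rightDeg T i - 1) 𝓣 (simplexPoints (n - d) d)

/-- The union of all members of `𝓜` on subsets of `τ`, as a set of edges.  For a linkage tope field
of thickness `k` and a `(k+1)`-set `τ` this is the linkage covector on `τ`. -/
def unionOn (𝓜 : Set (BipGraph n d)) (τ : Finset (Fin n)) : Set (Fin n × Fin d) :=
  {e | ∃ M ∈ 𝓜, ∃ σ ⊆ τ, leftDeg M = charVec σ ∧ e ∈ M}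

/-- The `i`-amalgamation of a tope field of type `v` and thickness `k`: the topes of type `v + e_i`
on `(k+1)`-sets `τ` of left nodes that are contained in the union of the topes on `τ`. -/
def amalgamation (v : Fin d → ℕ) (i : Fin d) (𝓜 : Set (BipGraph n d)) : Set (BipGraph n d) :=
  {G | ∃ τ : Finset (Fin n), #τ = ∑ j, v j + 1 ∧ IsTope (v + Pi.single i 1) τ G ∧
    ∀ e ∈ G, e ∈ unionOn 𝓜 τ}

/-- `IteratedAmalgamation 𝓜 v 𝓝`: the family `𝓝` of graphs, with type `v`, is obtained from the
matching field `𝓜` by a finite sequence of `i`-amalgamations, with arbitrary `i` in each step. -/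
inductive IteratedAmalgamation (𝓜 : Set (BipGraph n d)) :
    (Fin d → ℕ) → Set (BipGraph n d) → Prop
  | base : IteratedAmalgamation 𝓜 1 𝓜
  | step (v : Fin d → ℕ) (𝓝 : Set (BipGraph n d)) (i : Fin d) :
      IteratedAmalgamation 𝓜 v 𝓝 →
        IteratedAmalgamation 𝓜 (v + Pi.single i 1) (amalgamation v i 𝓝)

/-- The maximal topes of a linkage matching field: the topes of the tope fields of thickness `n`
obtained from it by iterated amalgamation. -/
def maximalTopes (𝓜 : Set (BipGraph n d)) : Set (BipGraph n d) :=
  {T | ∃ v 𝓝, IteratedAmalgamation 𝓜 v 𝓝 ∧ ∑ i, v i = n ∧ T ∈ 𝓝}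

/-- A matching: every node has degree at most one. -/
def IsMatching (P : BipGraph n d) : Prop :=
  (∀ j, leftDeg P j ≤ 1) ∧ ∀ i, rightDeg P i ≤ 1

/-- The (inclusion-)maximal matchings contained in the members of `𝓣`. -/
def maximalMatchings (𝓣 : Set (BipGraph n d)) : Set (BipGraph n d) :=
  {P | ∃ T ∈ 𝓣, Maximal (fun Q : BipGraph n d => Q ⊆ T ∧ IsMatching Q) P}

end TopeArr

namespace TopeArr

open Finset

set_option linter.unusedSectionVars false

/-! ### Partial functions, transversals and good topes. -/

section Core

variable {α β : Type*} [Fintype α] [DecidableEq α] [Fintype β] [DecidableEq β]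

/-! A graph with left degrees at most one is a partial function from left to right nodes. Call a
tope good if all its transversals (one element from each fibre) belong to the field. The key claim,
`LinkageField.exAt_and_uniqAt`, is that a linkage field has exactly one good tope of each positive
type on each set of the right size. Iterated amalgamation produces exactly the good topes, so the
maximal topes are the good ones on all left nodes.

The engine is the family of good topes `G i` of types `u + e_i` on one set. If `x` lies over `a` in
`G a` and over `b` in `G b`, deleting `x` leaves the same tope of type `u` in both, so they differ
by moving `x`. A count shows that such moves connect all nodes (`step_connected`). A move takes an
element only from the node with the excess, so whatever lies over `j` in some member lies over `j`
in `G j` (`eq_some_of_eq_some`). This yields uniqueness one step above `u`; existence two steps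
above comes from gluing topes on `σ \ x` and `σ \ y`.

Two different perfect matchings on the same nodes give a cycle in the digraph with arcs `F x → F'
x`. Moves inside the families bring the types of `F` and `F'` together while keeping a cycle; once
the types agree, uniqueness leaves only loops. Hence `LinkageField.not_cyclic`, which is
compatibility.

Conversely, acyclicity allows left nodes to be removed from an arrangement one at a time, so every
type occurs on every subset (`exists_restr_type`). Type `1` gives the matchings and type `1 + e_r`
the linkage axiom. The constructions are inverse because matchings on a set and good topes of a type
are unique. -/

/-- The fibre of a partial function over `i`. -/
def fib (f : α → Option β) (i : β) : Finset α := {x | f x = some i}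

/-- The domain of a partial function. -/
def dom (f : α → Option β) : Finset α := {x | f x ≠ none}

/-- Remove `x` from the domain of a partial function. -/
def del (f : α → Option β) (x : α) : α → Option β := Function.update f x none

/-- `g` is a restriction of `f`. -/
def Sub (g f : α → Option β) : Prop := ∀ x i, g x = some i → f x = some i

/-- All fibres are singletons. -/
def IsMatch (g : α → Option β) : Prop := ∀ i, #(fib g i) = 1

/-- All transversals of `f` belong to `𝓕`. -/
def Good (𝓕 : Set (α → Option β)) (f : α → Option β) : Prop :=
  ∀ g, Sub g f → IsMatch g → g ∈ 𝓕

/-- `f` is a tope of type `v` on `σ` all of whose transversals belong to `𝓕`. -/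
structure GoodTope (𝓕 : Set (α → Option β)) (v : β → ℕ) (σ : Finset α) (f : α → Option β) :
    Prop where
  dom_eq : dom f = σ
  card_fib : ∀ i, #(fib f i) = v i
  good : Good 𝓕 f

variable {𝓕 : Set (α → Option β)} {f g : α → Option β} {u v : β → ℕ} {σ τ : Finset α}
  {x y z : α} {i j r : β}

@[simp] lemma mem_fib : x ∈ fib f i ↔ f x = some i := by simp [fib]

@[simp] lemma mem_dom : x ∈ dom f ↔ f x ≠ none := by simp [dom]

@[simp] lemma del_self : del f x x = none := by simp [del]

lemma del_of_ne (h : y ≠ x) : del f x y = f y := by simp [del, h]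

lemma del_eq_some : del f x y = some i ↔ y ≠ x ∧ f y = some i := by
  by_cases h : y = x
  · subst h; simp
  · simp [del_of_ne h, h]

lemma sub_del : Sub (del f x) f := fun _ _ h => (del_eq_some.1 h).2

lemma Sub.trans {h : α → Option β} (h₁ : Sub f g) (h₂ : Sub g h) : Sub f h :=
  fun x i hx => h₂ x i (h₁ x i hx)

lemma Good.mono (hf : Good 𝓕 f) (h : Sub g f) : Good 𝓕 g :=
  fun k hk hm => hf k (hk.trans h) hm

lemma sum_card_fib (f : α → Option β) : ∑ i, #(fib f i) = #(dom f) := by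
  rw [← card_biUnion]
  · congr 1; ext x; simp [Option.ne_none_iff_exists', -ne_eq]
  · intro i _ j _ hij
    rw [Function.onFun, disjoint_left]
    intro x hx hy
    simp only [mem_fib] at hx hy
    exact hij (Option.some.inj (hx.symm.trans hy))

lemma GoodTope.sum_eq (h : GoodTope 𝓕 v σ f) : ∑ i, v i = #σ := by
  rw [← h.dom_eq, ← sum_card_fib]; exact sum_congr rfl fun i _ => (h.card_fib i).symm

lemma GoodTope.ne_none (h : GoodTope 𝓕 v σ f) : f x ≠ none ↔ x ∈ σ := by
  rw [← h.dom_eq, mem_dom]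

lemma GoodTope.mem_of_eq (h : GoodTope 𝓕 v σ f) (hx : f x = some i) : x ∈ σ :=
  h.ne_none.1 (by simp [hx])

lemma GoodTope.eq_none (h : GoodTope 𝓕 v σ f) (hx : x ∉ σ) : f x = none := by
  by_contra h'; exact hx (h.ne_none.1 h')

lemma GoodTope.exists_eq (h : GoodTope 𝓕 v σ f) (hx : x ∈ σ) : ∃ i, f x = some i :=
  Option.ne_none_iff_exists'.1 (h.ne_none.2 hx)

lemma GoodTope.del (h : GoodTope 𝓕 (u + Pi.single i 1) σ f) (hx : f x = some i) :
    GoodTope 𝓕 u (σ.erase x) (del f x) where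
  dom_eq := by
    ext y
    by_cases hy : y = x
    · subst hy; simp
    · simp only [mem_dom, del_of_ne hy, mem_erase]
      rw [h.ne_none]; simp [hy]
  card_fib j := by
    have hj := h.card_fib j
    by_cases hij : j = i
    · subst hij
      have : fib (TopeArr.del f x) j = (fib f j).erase x := by
        ext y; simp [del_eq_some]
      rw [this, card_erase_of_mem (by simpa using hx), hj]; simp
    · have : fib (TopeArr.del f x) j = fib f j := by
        ext y; simp only [mem_fib, del_eq_some]
        constructor
        · exact fun h => h.2
        · intro h
          refine ⟨?_, h⟩
          rintro rfl
          exact hij (Option.some.inj (h.symm.trans hx))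
      rw [this, hj]; simp [hij]
  good := h.good.mono sub_del

lemma update_del (hx : f x = some i) : Function.update (del f x) x (some i) = f := by
  ext1 y
  by_cases hy : y = x
  · subst hy; simp [hx]
  · simp [hy, del_of_ne hy]

/-- A partial function with two elements in a fibre is good if it is good without either. -/
lemma good_of_two (hxy : x ≠ y) (hx : f x = some i) (hy : f y = some i)
    (h₁ : Good 𝓕 (del f x)) (h₂ : Good 𝓕 (del f y)) : Good 𝓕 f := by
  intro g hg hm
  by_cases hgx : g x = none
  · refine h₁ g (fun z k hz => del_eq_some.2 ⟨?_, hg z k hz⟩) hm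
    rintro rfl; simp [hgx] at hz
  · refine h₂ g (fun z k hz => del_eq_some.2 ⟨?_, hg z k hz⟩) hm
    rintro rfl
    obtain ⟨l, hl⟩ := Option.ne_none_iff_exists'.1 hgx
    have e1 : l = i := Option.some.inj ((hg _ _ hl).symm.trans hx)
    have e2 : k = i := Option.some.inj ((hg _ _ hz).symm.trans hy)
    subst e1; subst e2
    exact hxy (card_le_one.1 (hm k).le x (by simpa using hl) z (by simpa using hz))

/-- Extending a tope by a new element in the fibre over `i`. -/
lemma GoodTope.update (hf : GoodTope 𝓕 u (σ.erase x) f) (hx : x ∈ σ)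
    (hg : Good 𝓕 (Function.update f x (some i))) :
    GoodTope 𝓕 (u + Pi.single i 1) σ (Function.update f x (some i)) where
  dom_eq := by
    ext y
    by_cases hy : y = x
    · subst hy; simpa using hx
    · rw [mem_dom, Function.update_of_ne hy, hf.ne_none]; simp [hy]
  card_fib j := by
    have hxn : f x = none := hf.eq_none (by simp)
    have hj := hf.card_fib j
    by_cases hij : j = i
    · subst hij
      have : fib (Function.update f x (some j)) j = insert x (fib f j) := by
        ext y
        by_cases hy : y = x
        · subst hy; simp
        · simp [hy]
      rw [this, card_insert_of_notMem (by simp [hxn]), hj]; simp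
    · have : fib (Function.update f x (some i)) j = fib f j := by
        ext y
        by_cases hy : y = x
        · subst hy; simp [hxn, Ne.symm hij]
        · simp [hy]
      rw [this, hj]; simp [hij]
  good := hg

/-- Glue two topes that differ in a single element over the same node. -/
lemma GoodTope.glue (hf : GoodTope 𝓕 u (σ.erase x) f) (hg : GoodTope 𝓕 u (σ.erase y) g)
    (hx : x ∈ σ) (hfy : f y = some i) (hgx : g x = some i) (h : TopeArr.del f y = TopeArr.del g x) :
    GoodTope 𝓕 (u + Pi.single i 1) σ (Function.update f x (some i)) := by
  have hxn : f x = none := hf.eq_none (by simp)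
  have hxy : x ≠ y := by rintro rfl; simp [hxn] at hfy
  refine hf.update hx (good_of_two hxy (i := i) (by simp) (by simp [hxy.symm, hfy]) ?_ ?_)
  · convert hf.good using 1
    ext1 z
    by_cases hz : z = x
    · subst hz; simp [hxn]
    · simp [del_of_ne hz, hz]
  · convert hg.good using 1
    rw [← update_del hgx, ← h, TopeArr.del, TopeArr.del, Function.update_comm hxy]

/-- Topes of type `v` are unique. -/
def UniqAt (𝓕 : Set (α → Option β)) (v : β → ℕ) : Prop :=
  ∀ σ f g, GoodTope 𝓕 v σ f → GoodTope 𝓕 v σ g → f = g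

/-- Topes of type `v` exist. -/
def ExAt (𝓕 : Set (α → Option β)) (v : β → ℕ) : Prop :=
  ∀ σ, #σ = ∑ i, v i → ∃ f, GoodTope 𝓕 v σ f

/-! ### The family of good topes of types `u + e_i` on a fixed set. -/

section Tree

variable {G : β → α → Option β}

/-- Two topes of neighbouring types are related by moving a single element. -/
def Step (G : β → α → Option β) (a b : β) : Prop := ∃ x, G a x = some a ∧ G b x = some b

variable (hu : UniqAt 𝓕 u) (hG : ∀ i, GoodTope 𝓕 (u + Pi.single i 1) τ (G i))
include hu hG

lemma eq_update_of_step {a b : β} (ha : G a x = some a) (hb : G b x = some b) :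
    G b = Function.update (G a) x (some b) := by
  have h := hu _ _ _ ((hG a).del ha) ((hG b).del hb)
  rw [← update_del hb, ← h]; simp [TopeArr.del]

/-- The invariants of a connected set of nodes. -/
structure Cluster (G : β → α → Option β) (u : β → ℕ) (i₀ : β) (A : Finset β) : Prop where
  mem : i₀ ∈ A
  -- Members of the cluster differ only in where they put elements among nodes of `A`. The bound in
  -- `card` is the vertex count of a tree: fibres of size `u i + 1`, each new one sharing at most
  -- one element with the earlier ones.
  agree : ∀ i ∈ A, ∀ i' ∈ A, ∀ z, G i' z = G i z ∨ ∃ l ∈ A, G i' z = some l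
  card : ∑ i ∈ A, u i + 1 ≤ #(A.biUnion fun i => fib (G i) i)
  conn : ∀ j ∈ A, Relation.ReflTransGen (Step G) i₀ j

omit hu in
lemma cluster_singleton (i : β) : Cluster G u i {i} where
  mem := by simp
  agree := by simp
  card := by simp [(hG i).card_fib]
  conn := by simp [Relation.ReflTransGen.refl]

/-- If the fibre of `j` shared a second element with the cluster, some `G a` with `a ∈ A` would
place `x` over `j ∉ A`, against `agree`. -/
lemma Cluster.insert {i₀ : β} {A : Finset β} (hA : Cluster G u i₀ A) (hj : j ∉ A) (hi : i ∈ A)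
    (hxi : G i x = some i) (hxj : G j x = some j) : Cluster G u i₀ (insert j A) where
  mem := by simp [hA.mem]
  agree := by
    have hup := eq_update_of_step hu hG hxi hxj
    have key : ∀ z, z ≠ x → G j z = G i z := fun z hz => by rw [hup]; simp [hz]
    intro a ha b hb z
    rw [mem_insert] at ha hb
    rcases hb with rfl | hb
    · by_cases hz : z = x
      · subst hz; exact Or.inr ⟨b, by simp, hxj⟩
      · rcases ha with rfl | ha
        · exact Or.inl rfl
        · rw [key z hz]
          rcases hA.agree a ha i hi z with h | ⟨l, hl, h⟩
          · exact Or.inl h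
          · exact Or.inr ⟨l, by simp [hl], h⟩
    · rcases ha with rfl | ha
      · rcases hA.agree i hi b hb z with h | ⟨l, hl, h⟩
        · by_cases hz : z = x
          · subst hz; exact Or.inr ⟨i, by simp [hi], h.trans hxi⟩
          · exact Or.inl (h.trans (key z hz).symm)
        · exact Or.inr ⟨l, by simp [hl], h⟩
      · rcases hA.agree a ha b hb z with h | ⟨l, hl, h⟩
        · exact Or.inl h
        · exact Or.inr ⟨l, by simp [hl], h⟩
  card := by
    have hsub : fib (G j) j ∩ (A.biUnion fun i => fib (G i) i) ⊆ {x} := by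
      intro y hy
      simp only [mem_inter, mem_fib, mem_biUnion] at hy
      obtain ⟨hyj, a, ha, hya⟩ := hy
      rw [mem_singleton]
      by_contra hne
      have hup := eq_update_of_step hu hG hya hyj
      have h1 : G a x = some j := by rw [← hxj, hup]; simp [Ne.symm hne]
      rcases hA.agree i hi a ha x with h | ⟨l, hl, h⟩
      · rw [h1, hxi] at h
        exact hj (Option.some.inj h ▸ hi)
      · rw [h1] at h
        exact hj (Option.some.inj h ▸ hl)
    have h1 := card_le_card hsub
    have h2 := card_union_add_card_inter (fib (G j) j) (A.biUnion fun i => fib (G i) i)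
    have h3 := hA.card
    have h4 := (hG j).card_fib j
    rw [sum_insert hj, biUnion_insert]
    simp at h1 h4
    omega
  conn := by
    intro k hk
    rw [mem_insert] at hk
    rcases hk with rfl | hk
    · exact (hA.conn i hi).tail ⟨x, hxi, hxj⟩
    · exact hA.conn k hk

/-- An inclusion-wise extension by `Cluster.insert` is possible as long as an own fibre of the
cluster meets one outside it, so a cluster of maximal size is separated from the rest. -/
lemma exists_cluster (S : Finset β) (hi : i ∈ S) : ∃ A ⊆ S, Cluster G u i A ∧
    Disjoint (A.biUnion fun i => fib (G i) i) ((S \ A).biUnion fun i => fib (G i) i) := by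
  classical
  let P : Finset (Finset β) := {A ∈ S.powerset | Cluster G u i A}
  obtain ⟨A, hA, hmax⟩ := exists_max_image P card
    ⟨{i}, by simpa [P, hi] using cluster_singleton hG i⟩
  simp only [P, mem_filter, mem_powerset] at hA
  refine ⟨A, hA.1, hA.2, ?_⟩
  rw [disjoint_left]
  intro x hx hx'
  simp only [mem_biUnion, mem_fib, mem_sdiff] at hx hx'
  obtain ⟨a, ha, hxa⟩ := hx
  obtain ⟨b, ⟨hbS, hb⟩, hxb⟩ := hx'
  have := hmax (Insert.insert b A) (by
    simp only [P, mem_filter, mem_powerset]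
    exact ⟨insert_subset hbS hA.1, hA.2.insert hu hG hb ha hxa hxb⟩)
  rw [card_insert_of_notMem hb] at this
  omega

/-- Split off separated clusters; each contributes a surplus of at least one. Two clusters in the
whole family would therefore need more elements than `τ` has, which is how connectedness follows. -/
lemma sum_lt_card_biUnion (S : Finset β) (hS : S.Nonempty) :
    ∑ i ∈ S, u i + 1 ≤ #(S.biUnion fun i => fib (G i) i) := by
  induction S using Finset.strongInduction with
  | H S ih =>
    obtain ⟨i, hi⟩ := hS
    obtain ⟨A, hAS, hA, hd⟩ := exists_cluster hu hG S hi
    by_cases h : (S \ A).Nonempty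
    · have h1 := ih (S \ A) (sdiff_ssubset hAS ⟨i, hA.mem⟩) h
      have h2 := hA.card
      have h3 := card_union_of_disjoint hd
      rw [← union_biUnion, union_sdiff_of_subset hAS] at h3
      have h4 := sum_sdiff hAS (f := u)
      omega
    · have : S = A := by
        rw [not_nonempty_iff_eq_empty, sdiff_eq_empty_iff_subset] at h
        exact h.antisymm hAS
      rw [this]; exact hA.card

omit hu in
lemma biUnion_fib_subset : (univ.biUnion fun i => fib (G i) i) ⊆ τ := by
  intro x hx
  simp only [mem_biUnion, mem_fib] at hx
  obtain ⟨a, -, hxa⟩ := hx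
  exact (hG a).mem_of_eq hxa

omit hu in
lemma card_eq_sum_add_one (i : β) : #τ = ∑ i, u i + 1 := by
  rw [← (hG i).sum_eq]; simp [sum_add_distrib]

/-- The topes of type `u + e_i` on a fixed set are connected by moves of single elements. -/
lemma step_connected (i j : β) : Relation.ReflTransGen (Step G) i j := by
  obtain ⟨A, hAS, hA, hd⟩ := exists_cluster hu hG univ (mem_univ i)
  by_cases h : (univ \ A).Nonempty
  · exfalso
    have h1 := sum_lt_card_biUnion hu hG _ h
    have h2 := hA.card
    have h3 := card_union_of_disjoint hd
    rw [← union_biUnion, union_sdiff_of_subset hAS] at h3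
    have h4 := sum_sdiff hAS (f := u)
    have h5 := card_le_card (biUnion_fib_subset hG)
    have h6 := card_eq_sum_add_one hG i
    omega
  · rw [not_nonempty_iff_eq_empty, sdiff_eq_empty_iff_subset] at h
    exact hA.conn j (h (mem_univ j))

lemma exists_fib_of_mem (hy : y ∈ τ) (i : β) : ∃ a, G a y = some a := by
  have h1 := sum_lt_card_biUnion hu hG univ ⟨i, mem_univ i⟩
  have h6 := card_eq_sum_add_one hG i
  have := eq_of_subset_of_card_le (biUnion_fib_subset hG) (by omega)
  rw [← this] at hy
  simpa using hy

/-- An edge of one of the topes of the tree at `j` is an edge of the tope with excess at `j`. -/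
lemma eq_some_of_eq_some (h : G i z = some j) : G j z = some j := by
  -- On the way to `j`, an element over `j` can only be moved by a step that starts at `j`.
  have key : ∀ a, Relation.ReflTransGen (Step G) i a → G j z = some j ∨ G a z = some j := by
    intro a ha
    induction ha with
    | refl => exact Or.inr h
    | @tail a b _ hab ih =>
      rcases ih with ih | ih
      · exact Or.inl ih
      · obtain ⟨x, hxa, hxb⟩ := hab
        by_cases haj : a = j
        · subst haj; exact Or.inl ih
        · right
          have hne : z ≠ x := by
            rintro rfl
            exact haj (Option.some.inj (hxa.symm.trans ih))
          rw [eq_update_of_step hu hG hxa hxb]; simp [hne, ih]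
  simpa using key j (step_connected hu hG i j)

/-- The own fibres cover `τ`, so `y` lies over `a` in some `G a`. Uniqueness in type `u` makes `N`
equal to `G a` without `y`. -/
lemma eq_some_of_goodTope_erase {N : α → Option β} (hN : GoodTope 𝓕 u (τ.erase y) N)
    (hy : y ∈ τ) (h : N z = some r) : G r z = some r := by
  obtain ⟨a, ha⟩ := exists_fib_of_mem hu hG hy r
  rw [hu _ _ _ hN ((hG a).del ha)] at h
  exact eq_some_of_eq_some hu hG (del_eq_some.1 h).2

end Tree

/-! ### Uniqueness one thickness up, and a lemma on nearly equal sets. -/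

lemma exists_eq_add_single (hv : ∀ i, 0 < v i) (h : Fintype.card β < ∑ i, v i) :
    ∃ (u : β → ℕ) (r : β), v = u + Pi.single r 1 ∧ ∀ i, 0 < u i := by
  obtain ⟨r, hr⟩ : ∃ r, 2 ≤ v r := by
    by_contra! hc
    have : ∑ i, v i ≤ ∑ _i : β, 1 := sum_le_sum fun i _ => by have := hc i; omega
    simp at this; omega
  refine ⟨v - Pi.single r 1, r, ?_, ?_⟩
  · ext i
    by_cases hi : i = r
    · subst hi; simp; omega
    · simp [hi]
  · intro i
    by_cases hi : i = r
    · subst hi; simp; omega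
    · simp [hi, hv i]

/-- Removing an element over `r` from `f` leaves a tope of type `u` that still has some `z` over
`r`, since `u r > 0`. Both `f` and `g` can serve as the member at `r` of the family, so both have
`z` over `r`, and they agree after deleting it. -/
lemma uniqAt_add_single (hpos : ∀ i, 0 < u i) (hu : UniqAt 𝓕 u)
    (hex : ∀ i, ExAt 𝓕 (u + Pi.single i 1)) (r : β) : UniqAt 𝓕 (u + Pi.single r 1) := by
  intro σ f g hf hg
  have hc : #σ = ∑ i, u i + 1 := by rw [← hf.sum_eq]; simp [sum_add_distrib]
  choose G₀ hG₀ using fun i => hex i σ (by rw [hc]; simp [sum_add_distrib])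
  have hG : ∀ h, GoodTope 𝓕 (u + Pi.single r 1) σ h →
      ∀ i, GoodTope 𝓕 (u + Pi.single i 1) σ (Function.update G₀ r h i) := by
    intro h hh i
    by_cases hi : i = r
    · subst hi; simpa using hh
    · simpa [hi] using hG₀ i
  have h1 := hf.card_fib r
  obtain ⟨y, hy⟩ := card_pos.1 (show 0 < #(fib f r) by simp [h1])
  rw [mem_fib] at hy
  have hN := hf.del hy
  obtain ⟨z, hz⟩ := card_pos.1 (show 0 < #(fib (del f y) r) by rw [hN.card_fib]; exact hpos r)
  rw [mem_fib] at hz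
  have e1 := eq_some_of_goodTope_erase hu (hG f hf) hN (hf.mem_of_eq hy) hz
  have e2 := eq_some_of_goodTope_erase hu (hG g hg) hN (hf.mem_of_eq hy) hz
  rw [Function.update_self] at e1 e2
  rw [← update_del e1, ← update_del e2, hu _ _ _ (hf.del e1) (hg.del e2)]

/-- Sets of size `t` indexed by the elements, not containing their index and pairwise meeting in
all but one element, lie in a common set of size `t + 1`. -/
lemma exists_common_superset {W : α → Finset α} {t : ℕ} (ht : 2 ≤ t) (hσ : σ.Nonempty)
    (hW : ∀ x ∈ σ, W x ⊆ σ) (hcard : ∀ x ∈ σ, #(W x) = t) (hmem : ∀ x ∈ σ, x ∉ W x)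
    (hint : ∀ x ∈ σ, ∀ y ∈ σ, t ≤ #(W x ∩ W y) + 1) :
    ∃ S ⊆ σ, #S = t + 1 ∧ ∀ x ∈ σ, W x ⊆ S := by
  obtain ⟨a, ha⟩ := hσ
  obtain ⟨b, hb⟩ := card_pos.1 (show 0 < #(W a) by rw [hcard a ha]; omega)
  have hbσ := hW a ha hb
  have hZ : #(W a ∩ W b) + 1 = t := by
    have h1 := hint a ha b hbσ
    have h2 : W a ∩ W b ⊂ W a := by
      refine ssubset_iff_of_subset inter_subset_left |>.2 ⟨b, hb, ?_⟩
      simp [hmem b hbσ]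
    have h3 := card_lt_card h2
    rw [hcard a ha] at h3; omega
  have hu := card_union_add_card_inter (W a) (W b)
  rw [hcard a ha, hcard b hbσ] at hu
  refine ⟨W a ∪ W b, union_subset (hW a ha) (hW b hbσ), by omega, ?_⟩
  intro x hx
  by_contra hns
  -- The alternative is a sunflower with core `W a ∩ W b`. It is excluded by a core element `c`: as
  -- `W c` omits `c`, it must contain everything else of `W a`, `W b` and `W x`, which is too much.
  obtain ⟨p, hp, hpn⟩ := not_subset.1 hns
  have hpa : p ∉ W a := fun h => hpn (mem_union_left _ h)
  have hpb : p ∉ W b := fun h => hpn (mem_union_right _ h)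
  obtain ⟨c, hc⟩ := card_pos.1 (show 0 < #(W a ∩ W b) by omega)
  have hca := (mem_inter.1 hc).1
  have hcb := (mem_inter.1 hc).2
  have hcσ := hW a ha hca
  -- `W x ∩ W a = W x ∩ W b = W x \ {p}`
  have ex : ∀ q ∈ σ, p ∉ W q → W x ∩ W q = (W x).erase p := by
    intro q hq hpq
    refine eq_of_subset_of_card_le (fun w hw => ?_) ?_
    · rw [mem_inter] at hw
      exact mem_erase.2 ⟨by rintro rfl; exact hpq hw.2, hw.1⟩
    · rw [card_erase_of_mem hp, hcard x hx]
      have := hint x hx q hq; omega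
  have hxab : (W x).erase p = W a ∩ W b := by
    refine eq_of_subset_of_card_le (fun w hw => mem_inter.2 ⟨?_, ?_⟩) ?_
    · rw [← ex a ha hpa] at hw; exact (mem_inter.1 hw).2
    · rw [← ex b hbσ hpb] at hw; exact (mem_inter.1 hw).2
    · rw [card_erase_of_mem hp, hcard x hx]; omega
  have hcx : c ∈ W x := mem_of_mem_erase (hxab ▸ hc)
  have ec : ∀ q ∈ σ, c ∈ W q → W c ∩ W q = (W q).erase c := by
    intro q hq hcq
    refine eq_of_subset_of_card_le (fun w hw => ?_) ?_
    · rw [mem_inter] at hw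
      exact mem_erase.2 ⟨by rintro rfl; exact hmem _ hcσ hw.1, hw.2⟩
    · rw [card_erase_of_mem hcq, hcard q hq]
      have := hint c hcσ q hq; omega
  have hsub : insert p ((W a ∪ W b).erase c) ⊆ W c := by
    intro w hw
    rw [mem_insert, mem_erase, mem_union] at hw
    rcases hw with rfl | ⟨hwc, hw | hw⟩
    · have : w ∈ (W x).erase c := mem_erase.2 ⟨by rintro rfl; exact hpa hca, hp⟩
      rw [← ec x hx hcx] at this
      exact (mem_inter.1 this).1
    · have : w ∈ (W a).erase c := mem_erase.2 ⟨hwc, hw⟩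
      rw [← ec a ha hca] at this
      exact (mem_inter.1 this).1
    · have : w ∈ (W b).erase c := mem_erase.2 ⟨hwc, hw⟩
      rw [← ec b hbσ hcb] at this
      exact (mem_inter.1 this).1
  have h1 := card_le_card hsub
  rw [card_insert_of_notMem (by simp [hpa, hpb]), card_erase_of_mem (mem_union_left _ hca),
    hcard c hcσ] at h1
  omega

end Core

/-! ### Existence of good topes two thicknesses up. -/

section Existence

variable {α β : Type*} [Fintype α] [DecidableEq α] [Fintype β] [DecidableEq β]
variable {𝓕 : Set (α → Option β)} {f g : α → Option β} {u v : β → ℕ} {σ τ : Finset α}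
  {x y z q : α} {i j r s : β} {G : α → β → α → Option β} {N : α → α → α → Option β}

/-- The topes of thickness `|σ| - 1` and `|σ| - 2` on subsets of `σ` with types near `u`. -/
structure Trees (𝓕 : Set (α → Option β)) (u : β → ℕ) (σ : Finset α)
    (G : α → β → α → Option β) (N : α → α → α → Option β) : Prop where
  uniq : UniqAt 𝓕 u
  tope : ∀ x ∈ σ, ∀ i, GoodTope 𝓕 (u + Pi.single i 1) (σ.erase x) (G x i)
  small : ∀ x ∈ σ, ∀ y ∈ σ, x ≠ y → GoodTope 𝓕 u ((σ.erase x).erase y) (N x y)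

lemma exists_trees (hc : #σ = ∑ i, u i + 2) (huniq : UniqAt 𝓕 u) (hex₀ : ExAt 𝓕 u)
    (hex : ∀ i, ExAt 𝓕 (u + Pi.single i 1)) : ∃ G N, Trees 𝓕 u σ G N := by
  have h1 : ∀ x, ∀ i, ∃ f, x ∈ σ → GoodTope 𝓕 (u + Pi.single i 1) (σ.erase x) f := by
    intro x i
    by_cases hx : x ∈ σ
    · obtain ⟨f, hf⟩ := hex i (σ.erase x) (by
        rw [card_erase_of_mem hx, hc]; simp [sum_add_distrib])
      exact ⟨f, fun _ => hf⟩
    · exact ⟨fun _ => none, fun h => absurd h hx⟩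
  have h2 : ∀ x y, ∃ f, x ∈ σ → y ∈ σ → x ≠ y → GoodTope 𝓕 u ((σ.erase x).erase y) f := by
    intro x y
    by_cases hx : x ∈ σ ∧ y ∈ σ ∧ x ≠ y
    · obtain ⟨f, hf⟩ := hex₀ ((σ.erase x).erase y) (by
        rw [card_erase_of_mem (mem_erase.2 ⟨hx.2.2.symm, hx.2.1⟩), card_erase_of_mem hx.1, hc]
        simp)
      exact ⟨f, fun _ _ _ => hf⟩
    · exact ⟨fun _ => none, fun h1 h2 h3 => absurd ⟨h1, h2, h3⟩ hx⟩
  choose G hG using h1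
  choose N hN using h2
  exact ⟨G, N, huniq, fun x hx i => hG x i hx, fun x hx y hy hxy => hN x y hx hy hxy⟩

namespace Trees

variable (h : Trees 𝓕 u σ G N)
include h

lemma small_comm (hx : x ∈ σ) (hy : y ∈ σ) (hxy : x ≠ y) : N x y = N y x := by
  have h1 := h.small x hx y hy hxy
  rw [erase_right_comm] at h1
  exact h.uniq _ _ _ h1 (h.small y hy x hx hxy.symm)

lemma ne_of_eq (hx : x ∈ σ) (hy : G x i y = some j) : y ≠ x :=
  ne_of_mem_erase ((h.tope x hx i).mem_of_eq hy)

lemma mem_of_eq (hx : x ∈ σ) (hy : G x i y = some j) : y ∈ σ :=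
  mem_of_mem_erase ((h.tope x hx i).mem_of_eq hy)

lemma del_eq (hx : x ∈ σ) (hy : G x i y = some i) : del (G x i) y = N x y :=
  h.uniq _ _ _ ((h.tope x hx i).del hy)
    (h.small x hx y (h.mem_of_eq hx hy) (h.ne_of_eq hx hy).symm)

lemma left_of_small (hx : x ∈ σ) (hy : y ∈ σ) (hxy : x ≠ y) (hz : N x y z = some i) :
    G x i z = some i :=
  eq_some_of_goodTope_erase h.uniq (h.tope x hx) (h.small x hx y hy hxy)
    (mem_erase.2 ⟨hxy.symm, hy⟩) hz

lemma right_of_small (hx : x ∈ σ) (hy : y ∈ σ) (hxy : x ≠ y) (hz : N x y z = some i) :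
    G y i z = some i :=
  h.left_of_small hy hx hxy.symm (h.small_comm hx hy hxy ▸ hz)

lemma transfer (hx : x ∈ σ) (hz : G x i z = some j) : G x j z = some j :=
  eq_some_of_eq_some h.uniq (h.tope x hx) hz

/-- All fibres over `r` of topes with excess at `r` lie in a common small set. -/
lemma exists_support (hpos : 0 < u r) (hσ : σ.Nonempty) : ∃ S ⊆ σ, #S = u r + 2 ∧
    ∀ x ∈ σ, fib (G x r) r ⊆ S := by
  refine exists_common_superset (t := u r + 1) (by omega) hσ ?_ ?_ ?_ ?_
  · exact fun x hx y hy => h.mem_of_eq hx (mem_fib.1 hy)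
  · exact fun x hx => by simp [(h.tope x hx r).card_fib]
  · exact fun x hx hxx => h.ne_of_eq hx (mem_fib.1 hxx) rfl
  · intro x hx y hy
    by_cases hxy : x = y
    · subst hxy; simp [(h.tope x hx r).card_fib]
    · have : fib (N x y) r ⊆ fib (G x r) r ∩ fib (G y r) r := fun z hz => by
        rw [mem_fib] at hz
        exact mem_inter.2 ⟨mem_fib.2 (h.left_of_small hx hy hxy hz),
          mem_fib.2 (h.right_of_small hx hy hxy hz)⟩
      have h1 := card_le_card this
      rw [(h.small x hx y hy hxy).card_fib] at h1
      omega

lemma fib_eq_erase {S : Finset α} (hS : #S = u r + 2) (hsub : ∀ x ∈ σ, fib (G x r) r ⊆ S)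
    (hx : x ∈ σ) (hxS : x ∈ S) : fib (G x r) r = S.erase x := by
  refine eq_of_subset_of_card_le (fun z hz => mem_erase.2 ⟨?_, hsub x hx hz⟩) ?_
  · exact h.ne_of_eq hx (mem_fib.1 hz)
  · rw [card_erase_of_mem hxS, hS, (h.tope x hx r).card_fib]; simp

/-- Two elements `x`, `y` of the common support lie over `r` in each other's topes, and deleting
them leaves the same `N x y`; so the topes glue. -/
lemma exists_add_single_add_single (hpos : 0 < u r) (hσ : σ.Nonempty) :
    ∃ f, GoodTope 𝓕 (u + Pi.single r 1 + Pi.single r 1) σ f := by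
  obtain ⟨S, hSσ, hS, hsub⟩ := h.exists_support hpos hσ
  obtain ⟨x, hx, y, hy, hxy⟩ := one_lt_card.1 (show 1 < #S by omega)
  have hyx : G x r y = some r := by
    rw [← mem_fib, h.fib_eq_erase hS hsub (hSσ hx) hx]; exact mem_erase.2 ⟨hxy.symm, hy⟩
  have hxy' : G y r x = some r := by
    rw [← mem_fib, h.fib_eq_erase hS hsub (hSσ hy) hy]; exact mem_erase.2 ⟨hxy, hx⟩
  refine ⟨_, (h.tope x (hSσ hx) r).glue (h.tope y (hSσ hy) r) (hSσ hx) hyx hxy' ?_⟩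
  rw [h.del_eq (hSσ hx) hyx, h.del_eq (hSσ hy) hxy', h.small_comm (hSσ hx) (hSσ hy) hxy]

/-! ### Excess at two different nodes. -/

section TwoNodes

variable (hrs : r ≠ s)
include hrs

/-- If `z` lies over `r` in the tope without `x` that has excess at `s`, and `q` lies over `s` there,
then `z` lies over `r` in the tope without `q` that has excess at `r`. -/
lemma cross (hx : x ∈ σ) (hz : G x s z = some r) (hq : G x s q = some s) :
    G q r z = some r := by
  have hzq : z ≠ q := by
    rintro rfl; exact hrs (Option.some.inj (hz.symm.trans hq))
  have : N x q z = some r := by rw [← h.del_eq hx hq]; exact del_eq_some.2 ⟨hzq, hz⟩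
  exact h.right_of_small hx (h.mem_of_eq hx hq) (h.ne_of_eq hx hq).symm this

/-- The topes without `y` and without `z` glue over `r`: away from `y`, `z`, `q` both coincide with
`G q r`, through the small topes omitting `q`. -/
lemma exists_of_two_cycle (hy : y ∈ σ) (hz : z ∈ σ) (hyz : G y s z = some r)
    (hzy : G z s y = some r) (hyq : G y s q = some s) (hzq : G z s q = some s) :
    ∃ f, GoodTope 𝓕 (u + Pi.single s 1 + Pi.single r 1) σ f := by
  have hq := h.mem_of_eq hy hyq
  have e1 := h.cross hrs hy hyz hyq
  have e2 := h.cross hrs hz hzy hzq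
  refine ⟨_, (h.tope y hy s).glue (h.tope z hz s) hy hyz hzy ?_⟩
  have nyz := h.ne_of_eq hy hyz
  have d1 := h.del_eq hq e1
  have d2 := h.del_eq hq e2
  have d3 := h.del_eq hy hyq
  have d4 := h.del_eq hz hzq
  have c1 := h.small_comm hy hq (h.ne_of_eq hy hyq).symm
  have c2 := h.small_comm hz hq (h.ne_of_eq hz hzq).symm
  ext1 w
  by_cases hwz : w = z
  · subst hwz
    rw [del_self, del_of_ne nyz, (h.tope w hz s).eq_none (by simp)]
  by_cases hwy : w = y
  · subst hwy
    rw [del_self, del_of_ne nyz.symm, (h.tope w hy s).eq_none (by simp)]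
  rw [del_of_ne hwz, del_of_ne hwy]
  by_cases hwq : w = q
  · rw [hwq, hyq, hzq]
  · rw [← del_of_ne (f := G y s) hwq, d3, c1, ← d2, del_of_ne hwy,
      ← del_of_ne (f := G z s) hwq, d4, c2, ← d1, del_of_ne hwz]

/-- The tope is `G z s` with `z` added over `r`. Deleting `q` or `q'` turns it into `G q r` or `G q'
r`, and a transversal avoids one of the two, as both lie over `s`. -/
lemma exists_of_back {S : Finset α} (hS : #S = u s + 2) (hsub : ∀ x ∈ σ, fib (G x s) s ⊆ S)
    {q' : α} (hz : z ∈ σ) (hqq : q ≠ q') (hzq : G z s q = some s) (hzq' : G z s q' = some s)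
    (hqz : G q s z = some r) :
    ∃ f, GoodTope 𝓕 (u + Pi.single s 1 + Pi.single r 1) σ f := by
  have hq := h.mem_of_eq hz hzq
  have hq' := h.mem_of_eq hz hzq'
  have hqS : q ∈ S := hsub z hz (mem_fib.2 hzq)
  have hqS' : q' ∈ S := hsub z hz (mem_fib.2 hzq')
  have e1 : G q s q' = some s := by
    rw [← mem_fib, h.fib_eq_erase hS hsub hq hqS]; exact mem_erase.2 ⟨hqq.symm, hqS'⟩
  have e2 : G q' s q = some s := by
    rw [← mem_fib, h.fib_eq_erase hS hsub hq' hqS']; exact mem_erase.2 ⟨hqq, hqS⟩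
  have hzne := h.ne_of_eq hz hzq
  have hzne' := h.ne_of_eq hz hzq'
  have e3 : G q' s z = some r := by
    have d1 : N q q' z = some r := by
      rw [← h.del_eq hq e1]; exact del_eq_some.2 ⟨hzne'.symm, hqz⟩
    rw [h.small_comm hq hq' hqq, ← h.del_eq hq' e2] at d1
    exact (del_eq_some.1 d1).2
  have key : ∀ p ∈ σ, G z s p = some s → G p s z = some r →
      Good 𝓕 (del (Function.update (G z s) z (some r)) p) := by
    intro p hp hzp hpz
    have hpr := h.transfer hp hpz
    have hne := h.ne_of_eq hz hzp
    convert (h.tope p hp r).good using 1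
    rw [← update_del hpr, h.del_eq hp hpr, h.small_comm hp hz hne, ← h.del_eq hz hzp, del, del,
      Function.update_comm hne.symm]
  refine ⟨_, (h.tope z hz s).update hz (good_of_two hqq (i := s) ?_ ?_ (key q hq hzq hqz)
    (key q' hq' hzq' e3))⟩
  · simp [hzne, hzq]
  · simp [hzne', hzq']

/-- Follow the map sending `x` to the element over `r` in `G x s`, along `x → y → z → w`. Either `w
= y`, a two-cycle, or the two-element fibres over `r` of `G q r` and `G p r` are `{y, z}` and `{z,
w}`. The image of `p` lies in both, hence is `z`, and `exists_of_back` applies. -/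
lemma exists_add_single_add_single_of_ne (hr : u r = 1) (hs : u s = 1) (hσ : σ.Nonempty) :
    ∃ f, GoodTope 𝓕 (u + Pi.single s 1 + Pi.single r 1) σ f := by
  obtain ⟨S, hSσ, hS, hsub⟩ := h.exists_support (r := s) (by omega) hσ
  have hcr : ∀ x ∈ σ, #(fib (G x s) r) = 1 := fun x hx => by
    rw [(h.tope x hx s).card_fib]; simp [hrs, hr]
  have hcs : ∀ x ∈ σ, #(fib (G x s) s) = 2 := fun x hx => by
    rw [(h.tope x hx s).card_fib]; simp [hs]
  have hce : ∀ x ∈ σ, #(fib (G x r) r) = 2 := fun x hx => by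
    rw [(h.tope x hx r).card_fib]; simp [hr]
  have hphi : ∀ x ∈ σ, ∃ y, G x s y = some r := fun x hx => by
    obtain ⟨y, hy⟩ := card_pos.1 (show 0 < #(fib (G x s) r) by rw [hcr x hx]; omega)
    exact ⟨y, mem_fib.1 hy⟩
  have hcommon : ∀ x ∈ σ, ∀ y ∈ σ, ∃ q, G x s q = some s ∧ G y s q = some s := by
    intro x hx y hy
    have h1 := card_union_add_card_inter (fib (G x s) s) (fib (G y s) s)
    have h2 := card_le_card (union_subset (hsub x hx) (hsub y hy))
    rw [hcs x hx, hcs y hy] at h1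
    obtain ⟨q, hq⟩ := card_pos.1 (show 0 < #(fib (G x s) s ∩ fib (G y s) s) by omega)
    exact ⟨q, by simpa using hq⟩
  have hpair : ∀ p ∈ σ, ∀ a b c, a ≠ b → G p r a = some r → G p r b = some r →
      G p r c = some r → c = a ∨ c = b := by
    intro p hp a b c hab ha hb hc
    have : ({a, b} : Finset α) = fib (G p r) r := eq_of_subset_of_card_le
      (by intro w hw; simp at hw; rcases hw with rfl | rfl <;> simpa) (by
        rw [hce p hp, card_pair hab])
    rw [← mem_fib, ← this] at hc
    simpa using hc
  obtain ⟨x, hx⟩ := hσ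
  obtain ⟨y, hxy⟩ := hphi x hx
  have hy := h.mem_of_eq hx hxy
  obtain ⟨z, hyz⟩ := hphi y hy
  have hz := h.mem_of_eq hy hyz
  obtain ⟨w, hzw⟩ := hphi z hz
  obtain ⟨q, hxq, hyq⟩ := hcommon x hx y hy
  obtain ⟨p, hyp, hzp⟩ := hcommon y hy z hz
  by_cases hwy : w = y
  · subst hwy
    exact h.exists_of_two_cycle hrs hy hz hyz hzw hyp hzp
  have hq := h.mem_of_eq hx hxq
  have hp := h.mem_of_eq hy hyp
  have nyz : y ≠ z := (h.ne_of_eq hy hyz).symm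
  have nzw : z ≠ w := (h.ne_of_eq hz hzw).symm
  have q1 := h.cross hrs hx hxy hxq
  have q2 := h.cross hrs hy hyz hyq
  have p1 := h.cross hrs hy hyz hyp
  have p2 := h.cross hrs hz hzw hzp
  have hpq : q ≠ p := by
    rintro rfl
    rcases hpair q hq y z w nyz q1 q2 p2 with e | e
    · exact hwy e
    · exact nzw e.symm
  have hpS : p ∈ S := hsub y hy (mem_fib.2 hyp)
  have hqS : q ∈ S := hsub y hy (mem_fib.2 hyq)
  have hpq' : G p s q = some s := by
    rw [← mem_fib, h.fib_eq_erase hS hsub hp hpS]; exact mem_erase.2 ⟨hpq, hqS⟩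
  obtain ⟨t, ht⟩ := hphi p hp
  have htz : t = z := by
    rcases hpair q hq y z t nyz q1 q2 (h.cross hrs hp ht hpq') with e | e
    · rcases hpair p hp z w t nzw p1 p2 (h.transfer hp ht) with e' | e'
      · exact e'
      · exact absurd (e'.symm.trans e) hwy
    · exact e
  rw [htz] at ht
  obtain ⟨p', hp', hne⟩ := exists_mem_ne (show 1 < #(fib (G z s) s) by rw [hcs z hz]; omega) p
  exact h.exists_of_back hrs hS hsub hz hne.symm hzp (mem_fib.1 hp') ht

end TwoNodes

end Trees

lemma exists_eq_add_single_add_single (hv : ∀ i, 0 < v i) (h : Fintype.card β + 1 < ∑ i, v i) :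
    ∃ (u : β → ℕ) (r s : β), v = u + Pi.single s 1 + Pi.single r 1 ∧ (∀ i, 0 < u i) ∧
      (r = s ∨ r ≠ s ∧ u r = 1 ∧ u s = 1) := by
  obtain ⟨w, s, rfl, hw⟩ := exists_eq_add_single hv (by omega)
  obtain ⟨u, r, rfl, hu⟩ := exists_eq_add_single hw (by
    simp [sum_add_distrib] at h ⊢; omega)
  -- An entry of at least three can be lowered twice at the same node. Otherwise all entries are at
  -- most two and the two lowered nodes differ.
  by_cases h3 : ∃ t, 3 ≤ (u + Pi.single r 1 + Pi.single s 1 : β → ℕ) t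
  · obtain ⟨t, ht⟩ := h3
    refine ⟨u + Pi.single r 1 + Pi.single s 1 - Pi.single t 1 - Pi.single t 1, t, t, ?_, ?_,
      Or.inl rfl⟩
    · ext i
      by_cases hi : i = t
      · subst hi; simp only [Pi.add_apply, Pi.sub_apply, Pi.single_eq_same] at ht ⊢; omega
      · simp [hi]
    · intro i
      by_cases hi : i = t
      · subst hi; simp only [Pi.add_apply, Pi.sub_apply, Pi.single_eq_same] at ht ⊢; omega
      · simp [hi]; have := hu i; omega
  · push Not at h3
    by_cases hrs : r = s
    · subst hrs
      have h1 := h3 r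
      have h2 := hu r
      simp at h1; omega
    · refine ⟨u, s, r, rfl, hu, Or.inr ⟨Ne.symm hrs, ?_, ?_⟩⟩
      · have h1 := h3 s
        have h2 := hu s
        simp [Ne.symm hrs] at h1; omega
      · have h1 := h3 r
        have h2 := hu r
        simp [hrs] at h1; omega

/-! ### One good tope of each type on each set. -/

/-- A linkage matching field, as a set of partial functions. -/
structure LinkageField (𝓕 : Set (α → Option β)) : Prop where
  isMatch : ∀ g ∈ 𝓕, IsMatch g
  exists_dom : ∀ σ : Finset α, #σ = Fintype.card β → ∃ g ∈ 𝓕, dom g = σ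
  eq_of_dom : ∀ g ∈ 𝓕, ∀ h ∈ 𝓕, dom g = dom h → g = h
  linkage : ∀ r, ∀ τ : Finset α, #τ = Fintype.card β + 1 →
    ∃ f, GoodTope 𝓕 ((1 : β → ℕ) + Pi.single r 1) τ f

lemma IsMatch.eq_of_sub (hf : IsMatch f) (hg : IsMatch g) (h : Sub g f) : g = f := by
  have : ∀ i, fib g i = fib f i := fun i =>
    eq_of_subset_of_card_le (fun x hx => mem_fib.2 (h x i (mem_fib.1 hx))) (by rw [hf i, hg i])
  ext x i
  rw [← mem_fib, this, mem_fib]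

lemma eq_one_of_sum_eq_card (hv : ∀ i, 0 < v i) (h : ∑ i, v i = Fintype.card β) : v = 1 := by
  have : ∀ i ∈ univ, 1 = v i := (sum_eq_sum_iff_of_le (fun i _ => hv i)).1 (by simpa using h.symm)
  ext i; exact (this i (mem_univ i)).symm

lemma LinkageField.exAt_and_uniqAt (h𝓕 : LinkageField 𝓕) :
    ∀ (k : ℕ) (v : β → ℕ), (∀ i, 0 < v i) → ∑ i, v i = k → ExAt 𝓕 v ∧ UniqAt 𝓕 v := by
  intro k
  induction k using Nat.strong_induction_on with
  | _ k ih =>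
  intro v hv hk
  have hge : Fintype.card β ≤ ∑ i, v i := by
    have : ∑ _i : β, 1 ≤ ∑ i, v i := sum_le_sum fun i _ => hv i
    simpa using this
  have hsing : ∀ (u : β → ℕ) r, ∑ i, (u + Pi.single r 1 : β → ℕ) i = ∑ i, u i + 1 := fun u r => by
    simp [sum_add_distrib]
  have hposing : ∀ (u : β → ℕ) r, (∀ i, 0 < u i) → ∀ i, 0 < (u + Pi.single r 1 : β → ℕ) i :=
    fun u r hu i => by have := hu i; simp only [Pi.add_apply]; omega
  -- Existence is needed for all types of thickness `k` first, since uniqueness uses the whole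
  -- family of types `u + e_i`.
  have hex : ∀ v : β → ℕ, (∀ i, 0 < v i) → ∑ i, v i = k → ExAt 𝓕 v := by
    clear hge hk hv v
    intro v hv hk
    have hge : Fintype.card β ≤ ∑ i, v i := by
      have : ∑ _i : β, 1 ≤ ∑ i, v i := sum_le_sum fun i _ => hv i
      simpa using this
    rcases Nat.lt_or_ge (Fintype.card β + 1) (∑ i, v i) with h2 | h2
    · obtain ⟨u, r, s, rfl, hu, hrs⟩ := exists_eq_add_single_add_single hv h2
      rw [hsing, hsing] at hk
      intro σ hσ
      rw [hsing, hsing] at hσ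
      obtain ⟨G, N, hT⟩ := exists_trees (σ := σ) hσ (ih _ (by omega) u hu rfl).2
        (ih _ (by omega) u hu rfl).1
        (fun i => (ih _ (by omega) _ (hposing u i hu) (hsing u i)).1)
      have hne : σ.Nonempty := card_pos.1 (by omega)
      rcases hrs with rfl | ⟨hrs, h1, h2⟩
      · exact hT.exists_add_single_add_single (hu r) hne
      · exact hT.exists_add_single_add_single_of_ne hrs h1 h2 hne
    · rcases Nat.lt_or_ge (Fintype.card β) (∑ i, v i) with h3 | h3
      · obtain ⟨u, r, rfl, hu⟩ := exists_eq_add_single hv h3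
        have hu1 : u = 1 := eq_one_of_sum_eq_card hu (by rw [hsing] at h2 h3; omega)
        intro σ hσ
        subst hu1
        exact h𝓕.linkage r σ (by rw [hσ, hsing]; simp)
      · have hv1 : v = 1 := eq_one_of_sum_eq_card hv (by omega)
        subst hv1
        intro σ hσ
        obtain ⟨g, hg, hd⟩ := h𝓕.exists_dom σ (by simpa using hσ)
        refine ⟨g, hd, h𝓕.isMatch g hg, fun f hf hm => ?_⟩
        rwa [(h𝓕.isMatch g hg).eq_of_sub hm hf]
  refine ⟨hex v hv hk, ?_⟩
  rcases Nat.lt_or_ge (Fintype.card β) (∑ i, v i) with h3 | h3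
  · obtain ⟨u, r, rfl, hu⟩ := exists_eq_add_single hv h3
    rw [hsing] at hk
    exact uniqAt_add_single hu (ih _ (by omega) u hu rfl).2
      (fun i => hex _ (hposing u i hu) (by rw [hsing, hk])) r
  · have hv1 : v = 1 := eq_one_of_sum_eq_card hv (by omega)
    subst hv1
    intro σ f g hf hg
    exact h𝓕.eq_of_dom f (hf.good f (fun _ _ h => h) hf.card_fib) g
      (hg.good g (fun _ _ h => h) hg.card_fib) (hf.dom_eq.trans hg.dom_eq.symm)

end Existence

/-! ### Cycles between two topes, and topes inside a family. -/

section Compatibility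

variable {α β : Type*} [Fintype α] [DecidableEq α] [Fintype β] [DecidableEq β]
variable {𝓕 : Set (α → Option β)} {f g F F' : α → Option β} {u v v' : β → ℕ} {σ τ : Finset α}
  {x y z : α} {a b i j r : β} {G : β → α → Option β}

/-- Every node of `I` is the tail of an arc `F x → F' x` that is no loop and has its head in `I`. -/
def Circulates (F F' : α → Option β) (I : Finset β) : Prop :=
  I.Nonempty ∧ ∀ i ∈ I, ∃ x, F x = some i ∧ ∃ j ∈ I, j ≠ i ∧ F' x = some j

/-- The digraph with the arcs `F x → F' x` has a cycle that is no loop. -/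
def Cyclic (F F' : α → Option β) : Prop := ∃ I, Circulates F F' I

lemma Cyclic.mono {f' : α → Option β} (h : Cyclic f f') (hF : Sub f F) (hF' : Sub f' F') :
    Cyclic F F' := by
  obtain ⟨I, hI, hc⟩ := h
  refine ⟨I, hI, fun i hi => ?_⟩
  obtain ⟨x, hx, j, hj, hji, hxj⟩ := hc i hi
  exact ⟨x, hF _ _ hx, j, hj, hji, hF' _ _ hxj⟩

/-- A digraph without sinks circulates. -/
lemma exists_circulating (A : α → Prop)
    (hne : ∃ y, A y ∧ ∃ p q, F y = some p ∧ F' y = some q ∧ q ≠ p)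
    (h : ∀ y, A y → ∀ p q, F y = some p → F' y = some q → q ≠ p →
      ∃ y', A y' ∧ ∃ q', F y' = some q ∧ F' y' = some q' ∧ q' ≠ q) :
    ∃ I : Finset β, I.Nonempty ∧
      ∀ i ∈ I, ∃ x, A x ∧ F x = some i ∧ ∃ j ∈ I, j ≠ i ∧ F' x = some j := by
  classical
  let I : Finset β := {q | ∃ y, A y ∧ ∃ p, F y = some p ∧ F' y = some q ∧ q ≠ p}
  refine ⟨I, ?_, ?_⟩
  · obtain ⟨y, hy, p, q, h1, h2, h3⟩ := hne
    exact ⟨q, by simpa [I] using ⟨y, hy, p, h1, h2, h3⟩⟩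
  · intro i hi
    obtain ⟨y, hy, p, h1, h2, h3⟩ := (mem_filter.1 hi).2
    obtain ⟨y', hy', q', h1', h2', h3'⟩ := h y hy p i h1 h2 h3
    exact ⟨y', hy', h1', q', by simpa [I] using ⟨y', hy', i, h1', h2', h3'⟩, h3', h2'⟩

/-- A node entered by an arc that is no loop is left by one if its degree does not increase. -/
lemma exists_leaving {D : Finset α} {q : β} (hD : D ⊆ fib F q) (hy : F' y = some q)
    (hFy : F y ≠ some q) (hc : #(fib F' q) ≤ #D) : ∃ y' ∈ D, F' y' ≠ some q := by
  by_contra! hcon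
  have hyD : y ∉ D := fun h => hFy (mem_fib.1 (hD h))
  have : insert y D ⊆ fib F' q := by
    intro w hw
    rcases mem_insert.1 hw with rfl | hw
    · exact mem_fib.2 hy
    · exact mem_fib.2 (hcon w hw)
  have := card_le_card this
  rw [card_insert_of_notMem hyD] at this
  omega

/-- Cycles persist when a node that loses an element has an excess in comparison. -/
lemma Cyclic.update (hF : GoodTope 𝓕 (u + Pi.single a 1) σ F) (hF' : GoodTope 𝓕 v' σ F')
    (hx : F x = some a)
    (hK : ∀ k, u k < v' k → k ≠ a ∧ ∃ e, F e = some k ∧ F' e ≠ some k)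
    (h : Cyclic F F') (b : β) : Cyclic (Function.update F x (some b)) F' := by
  -- The arc of `x` is discarded altogether, so its new place `b` is irrelevant; the remaining arcs
  -- have no sink.
  obtain ⟨I, hI, hc⟩ := exists_circulating (F := F) (F' := F') (fun y => y ≠ x) (by
    obtain ⟨I, ⟨i₀, hi₀⟩, hc⟩ := h
    obtain ⟨i, hi, hia⟩ : ∃ i ∈ I, i ≠ a := by
      by_cases h0 : i₀ = a
      · obtain ⟨_, _, j, hj, hji, _⟩ := hc i₀ hi₀
        exact ⟨j, hj, h0 ▸ hji⟩
      · exact ⟨i₀, hi₀, h0⟩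
    obtain ⟨y, hy, j, hj, hji, hyj⟩ := hc i hi
    refine ⟨y, ?_, i, j, hy, hyj, hji⟩
    rintro rfl
    exact hia (Option.some.inj (hy.symm.trans hx))) (by
    intro y hyx p q hp hq hqp
    have hfin : ∀ e, F e = some q → F' e ≠ some q → e ≠ x →
        ∃ y', y' ≠ x ∧ ∃ q', F y' = some q ∧ F' y' = some q' ∧ q' ≠ q := by
      intro e he he' hex
      obtain ⟨q', hq'⟩ := hF'.exists_eq (hF.mem_of_eq he)
      exact ⟨e, hex, q', he, hq', fun h => he' (h ▸ hq')⟩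
    by_cases hqK : u q < v' q
    · obtain ⟨hqa, e, he, he'⟩ := hK q hqK
      refine hfin e he he' ?_
      rintro rfl
      exact hqa (Option.some.inj (he.symm.trans hx))
    · have hcard : #((fib F q).erase x) = u q := by
        have h1 := hF.card_fib q
        by_cases hqa : q = a
        · subst hqa
          rw [card_erase_of_mem (mem_fib.2 hx), h1]; simp
        · rw [erase_eq_of_notMem, h1]
          · simp [hqa]
          · rw [mem_fib, hx]; exact fun h => hqa (Option.some.inj h).symm
      obtain ⟨e, he, he'⟩ := exists_leaving (erase_subset x (fib F q)) hq
        (by rw [hp]; exact fun h => hqp (Option.some.inj h).symm)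
        (by rw [hcard, hF'.card_fib]; omega)
      rw [mem_erase, mem_fib] at he
      exact hfin e he.2 he' he.1)
  refine ⟨I, hI, fun i hi => ?_⟩
  obtain ⟨y, hyx, hy, hj⟩ := hc i hi
  exact ⟨y, by rwa [Function.update_of_ne hyx], hj⟩

lemma sum_tsub_add_single (S : Finset β) (u v : β → ℕ) (b : β) :
    ∑ q ∈ S, ((u + Pi.single b 1 : β → ℕ) q - v q) =
      ∑ q ∈ S, (u q - v q) + if b ∈ S ∧ v b ≤ u b then 1 else 0 := by
  have : ∀ q, (u + Pi.single b 1 : β → ℕ) q - v q =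
      (u q - v q) + if q = b then (if v b ≤ u b then 1 else 0) else 0 := by
    intro q
    by_cases hq : q = b
    · subst hq
      simp only [Pi.add_apply, Pi.single_eq_same, if_true]
      split_ifs <;> omega
    · simp [hq]
  simp_rw [this, sum_add_distrib, sum_ite_eq', ite_and]

lemma exists_family (hex : ∀ i, ExAt 𝓕 (u + Pi.single i 1))
    (hF : GoodTope 𝓕 (u + Pi.single r 1) σ F) :
    ∃ G : β → α → Option β, G r = F ∧ ∀ i, GoodTope 𝓕 (u + Pi.single i 1) σ (G i) := by
  choose G hG using fun i => hex i σ (by rw [← hF.sum_eq]; simp [sum_add_distrib])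
  refine ⟨Function.update G r F, by simp, fun i => ?_⟩
  by_cases hi : i = r
  · subst hi; simpa using hF
  · simpa [hi] using hG i

lemma exists_sub_single (hv : ∀ i, 0 < v i) (hr : 2 ≤ v r) :
    ∃ u : β → ℕ, v = u + Pi.single r 1 ∧ ∀ i, 0 < u i := by
  refine ⟨v - Pi.single r 1, ?_, ?_⟩
  · ext i
    by_cases hi : i = r
    · subst hi; simp; omega
    · simp [hi]
  · intro i
    by_cases hi : i = r
    · subst hi; simp; omega
    · simp [hi, hv i]

lemma pos_add_single (hu : ∀ i, 0 < u i) (r i : β) : 0 < (u + Pi.single r 1 : β → ℕ) i := by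
  have := hu i; simp only [Pi.add_apply]; omega

/-- Move the excess of the second tope into the circulating set. -/
lemma exists_circulating_excess_mem {k : β} {I : Finset β} (hu : UniqAt 𝓕 u)
    (hG : ∀ i, GoodTope 𝓕 (u + Pi.single i 1) σ (G i)) (hI : Circulates F (G k) I) :
    ∃ b ∈ I, Circulates F (G b) I := by
  obtain ⟨i₀, hi₀⟩ := hI.1
  -- Until the excess enters `I`, a step moves an element that lies outside `I` in the second tope,
  -- so no arc inside `I` is affected.
  have key : ∀ a, Relation.ReflTransGen (Step G) k a →
      (∃ b ∈ I, Circulates F (G b) I) ∨ (a ∉ I ∧ Circulates F (G a) I) := by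
    intro a ha
    induction ha with
    | refl =>
      by_cases hk : k ∈ I
      · exact Or.inl ⟨k, hk, hI⟩
      · exact Or.inr ⟨hk, hI⟩
    | @tail a b _ hab ih =>
      rcases ih with ih | ⟨haI, hc⟩
      · exact Or.inl ih
      obtain ⟨x, hxa, hxb⟩ := hab
      have hb : Circulates F (G b) I := by
        refine ⟨hc.1, fun i hi => ?_⟩
        obtain ⟨y, hy, j, hj, hji, hyj⟩ := hc.2 i hi
        refine ⟨y, hy, j, hj, hji, ?_⟩
        have hyx : y ≠ x := by
          rintro rfl
          exact haI (Option.some.inj (hyj.symm.trans hxa) ▸ hj)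
        rwa [eq_update_of_step hu hG hxa hxb, Function.update_of_ne hyx]
      by_cases hbI : b ∈ I
      · exact Or.inl ⟨b, hbI, hb⟩
      · exact Or.inr ⟨hbI, hb⟩
  rcases key i₀ (step_connected hu hG k i₀) with h | h
  · exact h
  · exact absurd hi₀ h.1

/-- Move the first tope towards the type of the second one, keeping a cycle. -/
lemma exists_cyclic_closer {k : β} (hu : UniqAt 𝓕 u)
    (hG : ∀ i, GoodTope 𝓕 (u + Pi.single i 1) σ (G i)) (hF' : GoodTope 𝓕 v' σ F')
    (hr : v' r ≤ u r) (hk : u k < v' k)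
    (hK : ∀ k, u k < v' k → ∃ e, G r e = some k ∧ F' e ≠ some k) (h : Cyclic (G r) F') :
    ∃ k, u k < v' k ∧ Cyclic (G k) F' := by
  have key : ∀ a, Relation.ReflTransGen (Step G) r a →
      (∃ k, u k < v' k ∧ Cyclic (G k) F') ∨ (v' a ≤ u a ∧ Cyclic (G a) F' ∧
        ∀ k, u k < v' k → ∃ e, G a e = some k ∧ F' e ≠ some k) := by
    intro a ha
    induction ha with
    | refl => exact Or.inr ⟨hr, h, hK⟩
    | @tail a b _ hab ih =>
      rcases ih with ih | ⟨hau, hc, hKa⟩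
      · exact Or.inl ih
      obtain ⟨x, hxa, hxb⟩ := hab
      have hup := eq_update_of_step hu hG hxa hxb
      have hne : ∀ k, u k < v' k → k ≠ a := fun k hk => by rintro rfl; omega
      have hcb : Cyclic (G b) F' := by
        rw [hup]
        exact hc.update (hG a) hF' hxa (fun k hk => ⟨hne k hk, hKa k hk⟩) b
      by_cases hb : u b < v' b
      · exact Or.inl ⟨b, hb, hcb⟩
      · refine Or.inr ⟨by omega, hcb, fun k hk => ?_⟩
        obtain ⟨e, he, he'⟩ := hKa k hk
        refine ⟨e, ?_, he'⟩
        have hex : e ≠ x := by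
          rintro rfl
          exact hne k hk (Option.some.inj (he.symm.trans hxa))
        rwa [hup, Function.update_of_ne hex]
  rcases key k (step_connected hu hG r k) with h | h
  · exact h
  · exact absurd h.1 (by omega)

/-- Good topes of a linkage matching field on the same set do not form cycles. -/
theorem LinkageField.not_cyclic (h𝓕 : LinkageField 𝓕) (hv : ∀ i, 0 < v i) (hv' : ∀ i, 0 < v' i)
    (hF : GoodTope 𝓕 v σ F) (hF' : GoodTope 𝓕 v' σ F') : ¬ Cyclic F F' := by
  have hE := h𝓕.exAt_and_uniqAt
  -- The induction is lexicographic: `δ` is the total excess of `v'` over `v`, and `o` its share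
  -- outside `I`. The subtraction is truncated on purpose.
  obtain ⟨δ, hδ⟩ : ∃ δ, ∑ q, (v' q - v q) = δ := ⟨_, rfl⟩
  induction δ using Nat.strong_induction_on generalizing v v' F F' with
  | _ δ ihδ =>
  rintro ⟨I, hI⟩
  obtain ⟨o, ho⟩ : ∃ o, ∑ q ∈ univ \ I, (v' q - v q) = o := ⟨_, rfl⟩
  induction o using Nat.strong_induction_on generalizing v' F' I with
  | _ o iho =>
  by_cases hout : ∃ k ∉ I, v k < v' k
  · obtain ⟨k, hkI, hk⟩ := hout
    obtain ⟨u, rfl, hu⟩ := exists_sub_single hv' (r := k) (by have := hv k; omega)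
    obtain ⟨G, rfl, hG⟩ := exists_family
      (fun i => (hE _ _ (pos_add_single hu i) rfl).1) hF'
    -- Shifting a unit of `F'` from `k ∉ I` to `b ∈ I` either lowers `δ`, or keeps `δ` and lowers
    -- `o`.
    obtain ⟨b, hb, hc⟩ := exists_circulating_excess_mem (hE _ u hu rfl).2 hG hI
    have hvk : v k ≤ u k := by simpa [Nat.lt_succ_iff] using hk
    have e1 := sum_tsub_add_single univ u v k
    have e2 := sum_tsub_add_single univ u v b
    have e3 := sum_tsub_add_single (univ \ I) u v k
    have e4 := sum_tsub_add_single (univ \ I) u v b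
    simp only [mem_univ, mem_sdiff, hkI, not_false_eq_true, and_true, true_and, hvk, if_true,
      hb, not_true_eq_false, false_and, if_false] at e1 e2 e3 e4
    rcases Nat.lt_or_ge (∑ q, ((u + Pi.single b 1 : β → ℕ) q - v q)) δ with hlt | hge
    · exact ihδ _ hlt hv (pos_add_single hu b) hF (hG b) rfl ⟨I, hc⟩
    · refine iho _ ?_ (pos_add_single hu b) (hG b) ?_ I hc rfl
      · omega
      · split_ifs at e2 <;> omega
  · push Not at hout
    have hsum : ∑ q, v q = ∑ q, v' q := by rw [hF.sum_eq, hF'.sum_eq]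
    by_cases hvv : v = v'
    · subst hvv
      have := (hE _ v hv rfl).2 _ _ _ hF hF'
      subst this
      obtain ⟨⟨i, hi⟩, hc⟩ := hI
      obtain ⟨x, hx, j, hj, hji, hxj⟩ := hc i hi
      exact hji (Option.some.inj (hxj.symm.trans hx))
    have hlt1 : ∃ r, v' r < v r := by
      by_contra! hcon
      exact hvv (funext fun q =>
        ((sum_eq_sum_iff_of_le fun i _ => hcon i).1 hsum) q (mem_univ q))
    have hlt2 : ∃ k, v k < v' k := by
      by_contra! hcon
      exact hvv (funext fun q =>
        (((sum_eq_sum_iff_of_le fun i _ => hcon i).1 hsum.symm) q (mem_univ q)).symm)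
    obtain ⟨r, hr⟩ := hlt1
    obtain ⟨k, hk⟩ := hlt2
    obtain ⟨u, rfl, hu⟩ := exists_sub_single hv (r := r) (by have := hv' r; omega)
    obtain ⟨G, rfl, hG⟩ := exists_family
      (fun i => (hE _ _ (pos_add_single hu i) rfl).1) hF
    have hr' : v' r ≤ u r := by simpa [Nat.lt_succ_iff] using hr
    have hlow : ∀ q, q ≠ r → (u + Pi.single r 1 : β → ℕ) q = u q := fun q hq => by simp [hq]
    have huk : u k < v' k := by simp only [Pi.add_apply] at hk; omega
    -- All nodes where `v'` exceeds `v` now lie in `I`, so each has the leaving arc that keeps a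
    -- cycle alive; shifting a unit of `F` to such a node lowers `δ`.
    obtain ⟨k, hk, hc⟩ := exists_cyclic_closer (hE _ u hu rfl).2 hG hF' hr' huk (by
      intro k hk
      have hkr : k ≠ r := by rintro rfl; omega
      have hkI : k ∈ I := by
        by_contra hkI
        have := hout k hkI
        rw [hlow k hkr] at this; omega
      obtain ⟨e, he, j, _, hjk, hej⟩ := hI.2 k hkI
      exact ⟨e, he, by rw [hej]; exact fun h => hjk (Option.some.inj h)⟩) ⟨I, hI⟩
    refine ihδ _ ?_ (pos_add_single hu k) hv' (hG k) hF' rfl hc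
    rw [← hδ]
    refine sum_lt_sum (fun q _ => ?_) ⟨k, mem_univ k, ?_⟩
    · by_cases hq : q = r
      · subst hq
        have : v' q - (u + Pi.single k 1 : β → ℕ) q = 0 := by simp only [Pi.add_apply]; omega
        omega
      · rw [hlow q hq]; simp only [Pi.add_apply]; omega
    · have hkr : k ≠ r := by rintro rfl; omega
      rw [hlow k hkr]; simp only [Pi.add_apply, Pi.single_eq_same]; omega

/-- A tope inside the tree of topes near `u` is one of the topes of the tree. -/
lemma eq_of_forall_eq_some (hu : UniqAt 𝓕 u)
    (hG : ∀ i, GoodTope 𝓕 (u + Pi.single i 1) τ (G i))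
    (hg : ∀ j, #(fib g j) = (u + Pi.single i 1 : β → ℕ) j)
    (hsub : ∀ x j, g x = some j → G j x = some j) : g = G i := by
  have hcard : ∀ j, #(fib g j) = #(fib (G i) j) := fun j => by rw [hg, (hG i).card_fib]
  have hi : fib g i = fib (G i) i :=
    eq_of_subset_of_card_le (fun x hx => mem_fib.2 (hsub x i (mem_fib.1 hx))) (hcard i).ge
  by_cases hS : ∀ x j, g x = some j → G i x = some j
  · have : ∀ j, fib g j = fib (G i) j := fun j =>
      eq_of_subset_of_card_le (fun x hx => mem_fib.2 (hS x j (mem_fib.1 hx))) (hcard j).ge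
    ext x j
    rw [← mem_fib, this, mem_fib]
  exfalso
  push Not at hS
  obtain ⟨x₀, j₀, hx₀, hx₀'⟩ := hS
  -- Call a node bad if `g` has an element over it that `G i` puts elsewhere. Each bad node keeps an
  -- element sent to another bad node along the walk, because steps leave only nodes that are not
  -- bad. Reaching a bad `b` would contradict `hsub` at `b`.
  have key : ∀ a, Relation.ReflTransGen (Step G) i a →
      (¬ ∃ x, g x = some a ∧ G i x ≠ some a) ∧ ∀ j, (∃ x, g x = some j ∧ G i x ≠ some j) →
        ∃ x, g x = some j ∧ ∃ l, (∃ y, g y = some l ∧ G i y ≠ some l) ∧ l ≠ j ∧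
          G a x = some l := by
    intro a ha
    induction ha with
    | refl =>
      refine ⟨?_, ?_⟩
      · rintro ⟨x, hx, hx'⟩
        rw [← mem_fib, hi, mem_fib] at hx
        exact hx' hx
      · rintro j ⟨x, hx, hx'⟩
        obtain ⟨l, hl⟩ := (hG i).exists_eq ((hG j).mem_of_eq (hsub x j hx))
        have hlj : l ≠ j := by rintro rfl; exact hx' hl
        refine ⟨x, hx, l, ?_, hlj, hl⟩
        by_contra! hcon
        have : fib g l = fib (G i) l :=
          eq_of_subset_of_card_le (fun y hy => mem_fib.2 (hcon y (mem_fib.1 hy))) (hcard l).ge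
        rw [← mem_fib, ← this, mem_fib, hx] at hl
        exact hlj (Option.some.inj hl).symm
    | @tail a b _ hab ih =>
      obtain ⟨x, hxa, hxb⟩ := hab
      have hup := eq_update_of_step hu hG hxa hxb
      have hall : ∀ j, (∃ x, g x = some j ∧ G i x ≠ some j) →
        ∃ x, g x = some j ∧ ∃ l, (∃ y, g y = some l ∧ G i y ≠ some l) ∧ l ≠ j ∧
          G b x = some l := by
        intro j hj
        obtain ⟨y, hy, l, hl, hlj, hyl⟩ := ih.2 j hj
        refine ⟨y, hy, l, hl, hlj, ?_⟩
        have hyx : y ≠ x := by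
          rintro rfl
          exact ih.1 (Option.some.inj (hyl.symm.trans hxa) ▸ hl)
        rwa [hup, Function.update_of_ne hyx]
      refine ⟨fun hb => ?_, hall⟩
      obtain ⟨y, hy, l, -, hlb, hyl⟩ := hall b hb
      exact hlb (Option.some.inj (hyl.symm.trans (hsub y b hy)))
  exact (key j₀ (step_connected hu hG i j₀)).1 ⟨x₀, hx₀, hx₀'⟩

end Compatibility

/-! ### Dictionary between graphs and partial functions. -/

section Graphs

variable {n d : ℕ} {f g : Fin n → Option (Fin d)} {P P₁ P₂ G T : BipGraph n d} {v : Fin d → ℕ}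
  {σ τ : Finset (Fin n)} {x y : Fin n} {i j r : Fin d}

/-- The graph of a partial function. -/
def graphOf (f : Fin n → Option (Fin d)) : BipGraph n d :=
  univ.filter fun e : Fin n × Fin d => f e.1 = some e.2

@[simp] lemma mem_graphOf : (x, i) ∈ graphOf f ↔ f x = some i := by simp [graphOf]

lemma graphOf_subset : graphOf g ⊆ graphOf f ↔ Sub g f := by
  constructor
  · intro h x i hx
    exact mem_graphOf.1 (h (mem_graphOf.2 hx))
  · rintro h ⟨x, i⟩ hx
    exact mem_graphOf.2 (h x i (mem_graphOf.1 hx))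

lemma graphOf_injective : Function.Injective (graphOf : (Fin n → Option (Fin d)) → _) := by
  intro f g h
  ext x i
  rw [← mem_graphOf, h, mem_graphOf]

lemma eq_of_leftDeg_le (h : leftDeg P x ≤ 1) (hi : (x, i) ∈ P) (hj : (x, j) ∈ P) : i = j := by
  have := card_le_one.1 h (x, i) (by simp [hi]) (x, j) (by simp [hj])
  exact (Prod.mk.inj this).2

lemma eq_of_rightDeg_le (h : rightDeg P i ≤ 1) (hx : (x, i) ∈ P) (hy : (y, i) ∈ P) : x = y := by
  have := card_le_one.1 h (x, i) (by simp [hx]) (y, i) (by simp [hy])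
  exact (Prod.mk.inj this).1

lemma exists_of_leftDeg_pos (h : 0 < leftDeg P x) : ∃ i, (x, i) ∈ P := by
  obtain ⟨⟨y, i⟩, he⟩ := card_pos.1 h
  rw [mem_filter] at he
  obtain ⟨he, rfl⟩ := he
  exact ⟨i, he⟩

lemma exists_of_rightDeg_pos (h : 0 < rightDeg P i) : ∃ x, (x, i) ∈ P := by
  obtain ⟨⟨x, j⟩, he⟩ := card_pos.1 h
  rw [mem_filter] at he
  obtain ⟨he, rfl⟩ := he
  exact ⟨x, he⟩

lemma exists_eq_graphOf (h : ∀ x, leftDeg P x ≤ 1) : ∃ f, P = graphOf f := by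
  classical
  refine ⟨fun x => if hx : ∃ i, (x, i) ∈ P then some hx.choose else none, ?_⟩
  ext ⟨x, i⟩
  rw [mem_graphOf]
  constructor
  · intro hx
    have hex : ∃ i, (x, i) ∈ P := ⟨i, hx⟩
    rw [dif_pos hex, eq_of_leftDeg_le (h x) hex.choose_spec hx]
  · intro hx
    split_ifs at hx with hex
    rw [← Option.some.inj hx]
    exact hex.choose_spec

lemma rightDeg_graphOf (f : Fin n → Option (Fin d)) (i : Fin d) :
    rightDeg (graphOf f) i = #(fib f i) := by
  refine card_bij (fun e _ => e.1) ?_ ?_ ?_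
  · rintro ⟨x, j⟩ h
    simp only [mem_filter, mem_graphOf] at h
    simp [h.1, ← h.2]
  · rintro ⟨x, j⟩ h ⟨y, k⟩ h' hxy
    simp only [mem_filter] at h h' hxy
    rw [hxy, h.2, h'.2]
  · intro x hx
    exact ⟨(x, i), by simpa using hx, rfl⟩

lemma leftDeg_graphOf (f : Fin n → Option (Fin d)) : leftDeg (graphOf f) = charVec (dom f) := by
  ext x
  rw [charVec]
  split_ifs with hx
  · obtain ⟨i, hi⟩ := Option.ne_none_iff_exists'.1 (mem_dom.1 hx)
    refine card_eq_one.2 ⟨(x, i), ?_⟩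
    ext ⟨y, j⟩
    simp only [mem_filter, mem_graphOf, mem_singleton, Prod.mk.injEq]
    constructor
    · rintro ⟨h1, rfl⟩
      exact ⟨rfl, Option.some.inj (h1.symm.trans hi)⟩
    · rintro ⟨rfl, rfl⟩
      exact ⟨hi, rfl⟩
  · rw [mem_dom, not_not] at hx
    refine card_eq_zero.2 (eq_empty_of_forall_notMem ?_)
    rintro ⟨y, j⟩ h
    simp only [mem_filter, mem_graphOf] at h
    obtain ⟨h1, rfl⟩ := h
    simp [hx] at h1

lemma charVec_le_one (σ : Finset (Fin n)) (x : Fin n) : charVec σ x ≤ 1 := by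
  rw [charVec]; split_ifs <;> simp

lemma charVec_injective : Function.Injective (charVec : Finset (Fin n) → _) := by
  intro σ τ h
  ext x
  have := congrFun h x
  simp only [charVec] at this
  split_ifs at this <;> simp_all

lemma leftDeg_graphOf_eq_charVec : leftDeg (graphOf f) = charVec σ ↔ dom f = σ := by
  rw [leftDeg_graphOf, charVec_injective.eq_iff]

lemma isTope_graphOf : IsTope v σ (graphOf f) ↔
    (∀ i, 0 < v i) ∧ (∀ i, #(fib f i) = v i) ∧ dom f = σ := by
  rw [IsTope, leftDeg_graphOf_eq_charVec, funext_iff]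
  simp_rw [rightDeg_graphOf]

lemma IsTope.exists_eq_graphOf (h : IsTope v σ G) : ∃ f, G = graphOf f :=
  TopeArr.exists_eq_graphOf fun x => by rw [h.2.2]; exact charVec_le_one σ x

/-- The restriction of a partial function. -/
def restr (f : Fin n → Option (Fin d)) (σ : Finset (Fin n)) (x : Fin n) : Option (Fin d) :=
  if x ∈ σ then f x else none

lemma restr_eq_some : restr f σ x = some i ↔ x ∈ σ ∧ f x = some i := by
  by_cases h : x ∈ σ <;> simp [restr, h]

lemma sub_restr : Sub (restr f σ) f := fun _ _ h => (restr_eq_some.1 h).2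

lemma restr_univ : restr f univ = f := by ext; simp [restr_eq_some]

lemma dom_restr (h : σ ⊆ dom f) : dom (restr f σ) = σ := by
  ext x
  by_cases hx : x ∈ σ
  · simpa [restr, hx] using h hx
  · simp [restr, hx]

lemma isPerfectMatchingOn_graphOf {J : Finset (Fin n)} {I : Finset (Fin d)}
    (hmaps : ∀ x ∈ J, ∃ i ∈ I, f x = some i) (hI : ∀ i ∈ I, #(fib (restr f J) i) = 1) :
    IsPerfectMatchingOn J I (graphOf (restr f J)) := by
  refine ⟨?_, ?_, ?_⟩
  · rintro ⟨x, i⟩ h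
    rw [mem_graphOf, restr_eq_some] at h
    obtain ⟨k, hk, hxk⟩ := hmaps x h.1
    rw [h.2] at hxk
    exact ⟨h.1, Option.some.inj hxk ▸ hk⟩
  · intro x hx
    rw [leftDeg_graphOf, dom_restr, charVec, if_pos hx]
    intro y hy
    obtain ⟨k, -, hk⟩ := hmaps y hy
    simp [hk]
  · intro i hi
    rw [rightDeg_graphOf, hI i hi]

/-- The right nodes at which two perfect matchings on the same node set differ form a circulating
set. -/
lemma compatible_of_not_cyclic (h : ¬ Cyclic f g) : Compatible (graphOf f) (graphOf g) := by
  classical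
  intro J I P₁ P₂ h₁ h₂ hP₁ hP₂
  by_contra hne
  refine h ⟨{i ∈ I | ∃ x, (x, i) ∈ P₁ ∧ (x, i) ∉ P₂}, ?_, ?_⟩
  · by_contra hemp
    rw [not_nonempty_iff_eq_empty, filter_eq_empty_iff] at hemp
    have hsub : P₁ ⊆ P₂ := by
      rintro ⟨x, i⟩ hx
      by_contra hx'
      exact hemp (hP₁.1 _ hx).2 ⟨x, hx, hx'⟩
    refine hne (hsub.antisymm ?_)
    rintro ⟨x, i⟩ hx
    have hxJ := (hP₂.1 _ hx).1
    obtain ⟨j, hj⟩ := exists_of_leftDeg_pos (by rw [hP₁.2.1 x hxJ]; exact one_pos)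
    rwa [eq_of_leftDeg_le (hP₂.2.1 x hxJ).le hx (hsub hj)]
  · intro i hi
    obtain ⟨hiI, x, hx, hx'⟩ := mem_filter.1 hi
    have hxJ := (hP₁.1 _ hx).1
    obtain ⟨j, hj⟩ := exists_of_leftDeg_pos (by rw [hP₂.2.1 x hxJ]; exact one_pos)
    have hjI := (hP₂.1 _ hj).2
    have hji : j ≠ i := by rintro rfl; exact hx' hj
    refine ⟨x, mem_graphOf.1 (h₁ hx), j, mem_filter.2 ⟨hjI, ?_⟩, hji, mem_graphOf.1 (h₂ hj)⟩
    obtain ⟨y, hy⟩ := exists_of_rightDeg_pos (by rw [hP₁.2.2 j hjI]; exact one_pos)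
    refine ⟨y, hy, fun hy' => hji ?_⟩
    have hyx := eq_of_rightDeg_le (hP₂.2.2 j hjI).le hy' hj
    subst hyx
    exact eq_of_leftDeg_le (hP₁.2.1 y hxJ).le hy hx

/-- On a minimal closed set the successor map is a permutation without fixed points; the tails and
the heads of its arcs give two different perfect matchings. -/
lemma not_cyclic_of_compatible (h : Compatible (graphOf f) (graphOf g)) : ¬ Cyclic f g := by
  classical
  rintro ⟨I, ⟨i₀, hi₀⟩, hI⟩
  have hI' : ∀ i, ∃ (c : Fin n) (p : Fin d),
      i ∈ I → f c = some i ∧ p ∈ I ∧ p ≠ i ∧ g c = some p := by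
    intro i
    by_cases hi : i ∈ I
    · obtain ⟨x, hx, j, hj, hji, hxj⟩ := hI i hi
      exact ⟨x, j, fun _ => ⟨hx, hj, hji, hxj⟩⟩
    · obtain ⟨x, -⟩ := hI i₀ hi₀
      exact ⟨x, i, fun h => absurd h hi⟩
  choose c p hcp using hI'
  -- a minimal nonempty set closed under `p`
  obtain ⟨S, hS, hmin⟩ := exists_min_image
    {S ∈ I.powerset | S.Nonempty ∧ S.image p ⊆ S} card ⟨I, by
      simp only [mem_filter, mem_powerset, Subset.refl, true_and]
      exact ⟨⟨i₀, hi₀⟩, image_subset_iff.2 fun i hi => (hcp i hi).2.1⟩⟩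
  simp only [mem_filter, mem_powerset] at hS hmin
  obtain ⟨hSI, ⟨s, hs⟩, hSp⟩ := hS
  have hle := hmin (S.image p) ⟨hSp.trans hSI, ⟨p s, mem_image_of_mem p hs⟩,
    image_subset_image hSp⟩
  have hinj : Set.InjOn p S := card_image_iff.1 (le_antisymm card_image_le hle)
  have himg : S.image p = S := eq_of_subset_of_card_le hSp hle
  have hf : ∀ i ∈ S, f (c i) = some i := fun i hi => (hcp i (hSI hi)).1
  have hg : ∀ i ∈ S, g (c i) = some (p i) := fun i hi => (hcp i (hSI hi)).2.2.2
  have e := h (S.image c) S (graphOf (restr f (S.image c))) (graphOf (restr g (S.image c)))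
    (graphOf_subset.2 sub_restr) (graphOf_subset.2 sub_restr)
    (isPerfectMatchingOn_graphOf (by
      intro x hx
      obtain ⟨i, hi, rfl⟩ := mem_image.1 hx
      exact ⟨i, hi, hf i hi⟩) (by
      intro i hi
      refine card_eq_one.2 ⟨c i, ?_⟩
      ext x
      simp only [mem_fib, restr_eq_some, mem_image, mem_singleton]
      constructor
      · rintro ⟨⟨k, hk, rfl⟩, hx⟩
        rw [hf k hk] at hx
        rw [Option.some.inj hx]
      · rintro rfl
        exact ⟨⟨i, hi, rfl⟩, hf i hi⟩))
    (isPerfectMatchingOn_graphOf (by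
      intro x hx
      obtain ⟨i, hi, rfl⟩ := mem_image.1 hx
      exact ⟨p i, hSp (mem_image_of_mem p hi), hg i hi⟩) (by
      intro i hi
      rw [← himg] at hi
      obtain ⟨l, hl, rfl⟩ := mem_image.1 hi
      refine card_eq_one.2 ⟨c l, ?_⟩
      ext x
      simp only [mem_fib, restr_eq_some, mem_image, mem_singleton]
      constructor
      · rintro ⟨⟨k, hk, rfl⟩, hx⟩
        rw [hg k hk] at hx
        rw [hinj hk hl (Option.some.inj hx)]
      · rintro rfl
        exact ⟨⟨l, hl, rfl⟩, hg l hl⟩))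
  have h1 := congrFun (graphOf_injective e) (c s)
  simp only [restr, mem_image_of_mem c hs, if_true, hf s hs, hg s hs] at h1
  exact (hcp s (hSI hs)).2.2.1 (Option.some.inj h1).symm

/-- The maximal matchings of a tope are its transversals. -/
lemma maximal_iff (hf : ∀ i, 0 < #(fib f i)) :
    Maximal (fun Q : BipGraph n d => Q ⊆ graphOf f ∧ IsMatching Q) P ↔
      ∃ g, P = graphOf g ∧ Sub g f ∧ IsMatch g := by
  constructor
  · intro h
    obtain ⟨g, rfl⟩ := exists_eq_graphOf h.prop.2.1
    have hsub := graphOf_subset.1 h.prop.1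
    refine ⟨g, rfl, hsub, fun i => ?_⟩
    have hle := h.prop.2.2 i
    rw [rightDeg_graphOf] at hle
    by_contra hne
    have hi0 : fib g i = ∅ := card_eq_zero.1 (by omega)
    obtain ⟨x, hx⟩ := card_pos.1 (hf i)
    rw [mem_fib] at hx
    have hgi : ∀ y, g y ≠ some i := fun y hy => by
      have : y ∈ fib g i := mem_fib.2 hy
      simp [hi0] at this
    have hgx : g x = none := by
      by_contra hgx
      obtain ⟨l, hl⟩ := Option.ne_none_iff_exists'.1 hgx
      have := hsub x l hl
      rw [hx] at this
      exact hgi x (Option.some.inj this ▸ hl)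
    have hQ : IsMatching (graphOf (Function.update g x (some i))) := by
      refine ⟨fun y => by rw [leftDeg_graphOf]; exact charVec_le_one _ _, fun k => ?_⟩
      rw [rightDeg_graphOf]
      have hk := h.prop.2.2 k
      rw [rightDeg_graphOf] at hk
      by_cases hki : k = i
      · subst hki
        refine card_le_one.2 fun a ha b hb => ?_
        have : ∀ a, Function.update g x (some k) a = some k → a = x := fun a ha => by
          by_contra hax
          rw [Function.update_of_ne hax] at ha
          exact hgi a ha
        rw [this a (mem_fib.1 ha), this b (mem_fib.1 hb)]
      · refine le_trans (card_le_card fun a ha => ?_) hk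
        rw [mem_fib] at ha ⊢
        by_cases hax : a = x
        · subst hax
          simp only [Function.update_self] at ha
          exact absurd (Option.some.inj ha).symm hki
        · rwa [Function.update_of_ne hax] at ha
    have hle := h.le_of_ge (y := graphOf (Function.update g x (some i)))
      ⟨graphOf_subset.2 fun a k ha => by
        by_cases hax : a = x
        · subst hax
          rw [Function.update_self] at ha
          rw [hx, ha]
        · rw [Function.update_of_ne hax] at ha
          exact hsub a k ha, hQ⟩
      (graphOf_subset.2 fun a k ha => by
        have hax : a ≠ x := by rintro rfl; simp [hgx] at ha
        rwa [Function.update_of_ne hax])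
    exact hgi x (graphOf_subset.1 hle x i (by simp))
  · rintro ⟨g, rfl, hsub, hm⟩
    refine ⟨⟨graphOf_subset.2 hsub, fun y => ?_, fun i => ?_⟩, ?_⟩
    · rw [leftDeg_graphOf]; exact charVec_le_one _ _
    · rw [rightDeg_graphOf, hm i]
    · intro Q hQ hle
      obtain ⟨k, rfl⟩ := exists_eq_graphOf hQ.2.1
      have hgk := graphOf_subset.1 hle
      refine graphOf_subset.2 fun x i hx => ?_
      have : fib g i = fib k i := eq_of_subset_of_card_le
        (fun x hx => mem_fib.2 (hgk x i (mem_fib.1 hx))) (by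
          rw [hm i, ← rightDeg_graphOf]; exact hQ.2.2 i)
      rw [← mem_fib, this, mem_fib]
      exact hx

end Graphs

/-! ### Linkage matching fields and their maximal topes. -/

section Fields

variable {n d : ℕ} {𝓜 𝓣 : Set (BipGraph n d)} {f g : Fin n → Option (Fin d)}
  {P G T : BipGraph n d} {v : Fin d → ℕ} {σ τ : Finset (Fin n)} {x y : Fin n} {i j r : Fin d}

/-- The partial functions whose graphs belong to `𝓜`. -/
def fieldOf (𝓜 : Set (BipGraph n d)) : Set (Fin n → Option (Fin d)) := {f | graphOf f ∈ 𝓜}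

lemma IsMatch.goodTope {𝓕 : Set (Fin n → Option (Fin d))} (hm : IsMatch f) (hf : f ∈ 𝓕) :
    GoodTope 𝓕 1 (dom f) f where
  dom_eq := rfl
  card_fib := hm
  good g hg hgm := by rwa [hm.eq_of_sub hgm hg]

lemma IsLinkageMatchingField.isMatch (h : IsLinkageMatchingField 𝓜) (hf : graphOf f ∈ 𝓜) :
    IsMatch f := by
  obtain ⟨σ, -, hσ⟩ := h.1.2.2.1 _ hf
  exact (isTope_graphOf.1 hσ).2.1

lemma IsLinkageMatchingField.exists_eq_graphOf (h : IsLinkageMatchingField 𝓜) (hG : G ∈ 𝓜) :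
    ∃ f, G = graphOf f := by
  obtain ⟨σ, -, hσ⟩ := h.1.2.2.1 _ hG
  exact hσ.exists_eq_graphOf

lemma IsLinkageMatchingField.linkageField (h : IsLinkageMatchingField 𝓜) :
    LinkageField (fieldOf 𝓜) where
  isMatch g hg := h.isMatch hg
  exists_dom σ hσ := by
    obtain ⟨G, ⟨hG, hT⟩, -⟩ := h.1.2.2.2 σ (by simpa using hσ)
    obtain ⟨f, rfl⟩ := hT.exists_eq_graphOf
    exact ⟨f, hG, (isTope_graphOf.1 hT).2.2⟩
  eq_of_dom f hf g hg hfg := by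
    have hc : #(dom f) = ∑ i : Fin d, (1 : Fin d → ℕ) i := by
      rw [← sum_card_fib]; exact sum_congr rfl fun i _ => h.isMatch hf i
    refine graphOf_injective ((h.1.2.2.2 (dom f) hc).unique
      ⟨hf, isTope_graphOf.2 ⟨by simp, h.isMatch hf, rfl⟩⟩
      ⟨hg, isTope_graphOf.2 ⟨by simp, h.isMatch hg, hfg.symm⟩⟩)
  linkage r τ hτ := by
    obtain ⟨a, ha, b, hb, hab, A, hA, B, hB, hdA, hdB, hAB⟩ := h.2 r τ (by simpa using hτ)
    obtain ⟨p, rfl⟩ := h.exists_eq_graphOf hA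
    obtain ⟨q, rfl⟩ := h.exists_eq_graphOf hB
    rw [leftDeg_graphOf_eq_charVec] at hdA hdB
    simp only [mem_graphOf] at hAB
    have hp := (h.isMatch hA).goodTope (𝓕 := fieldOf 𝓜) hA
    have hq := (h.isMatch hB).goodTope (𝓕 := fieldOf 𝓜) hB
    rw [hdA] at hp
    rw [hdB] at hq
    -- The matching on `τ \ b` does not cover `b`, so agreement off `r` forces `b` over `r` in the
    -- other one; likewise for `a`.
    have hpb : p b = some r := by
      obtain ⟨i, hi⟩ := hp.exists_eq (mem_erase.2 ⟨hab.symm, hb⟩)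
      by_cases hir : i = r
      · rwa [← hir]
      · rw [hAB b i hir, hq.eq_none (by simp)] at hi
        simp at hi
    have hqa : q a = some r := by
      obtain ⟨i, hi⟩ := hq.exists_eq (mem_erase.2 ⟨hab, ha⟩)
      by_cases hir : i = r
      · rwa [← hir]
      · rw [← hAB a i hir, hp.eq_none (by simp)] at hi
        simp at hi
    refine ⟨_, hp.glue hq ha hpb hqa ?_⟩
    ext x i
    rw [del_eq_some, del_eq_some]
    by_cases hir : i = r
    · subst hir
      have e1 : p x = some i → x = b := fun hx =>
        card_le_one.1 (h.isMatch hA i).le x (mem_fib.2 hx) b (mem_fib.2 hpb)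
      have e2 : q x = some i → x = a := fun hx =>
        card_le_one.1 (h.isMatch hB i).le x (mem_fib.2 hx) a (mem_fib.2 hqa)
      constructor
      · exact fun hx => absurd (e1 hx.2) hx.1
      · exact fun hx => absurd (e2 hx.2) hx.1
    · rw [hAB x i hir]
      refine and_congr_left fun hx => ?_
      constructor
      · rintro - rfl
        exact hir (Option.some.inj (hx.symm.trans hqa))
      · rintro - rfl
        rw [← hAB x i hir] at hx
        exact hir (Option.some.inj (hx.symm.trans hpb))

/-- Iterated amalgamations consist of the topes all of whose transversals belong to the field. -/
lemma IsLinkageMatchingField.iteratedAmalgamation (h : IsLinkageMatchingField 𝓜)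
    {𝓝 : Set (BipGraph n d)} (hI : IteratedAmalgamation 𝓜 v 𝓝) : (∀ i, 0 < v i) ∧
      ∀ G, G ∈ 𝓝 ↔ ∃ σ f, GoodTope (fieldOf 𝓜) v σ f ∧ G = graphOf f := by
  induction hI with
  | base =>
    refine ⟨by simp, fun G => ⟨fun hG => ?_, ?_⟩⟩
    · obtain ⟨f, rfl⟩ := h.exists_eq_graphOf hG
      exact ⟨_, f, (h.isMatch hG).goodTope hG, rfl⟩
    · rintro ⟨σ, f, hf, rfl⟩
      exact hf.good f (fun _ _ h => h) hf.card_fib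
  | step v 𝓝 i _ ih =>
    obtain ⟨hv, h𝓝⟩ := ih
    have hE := h.linkageField.exAt_and_uniqAt
    refine ⟨pos_add_single hv i, fun G => ⟨?_, ?_⟩⟩
    · rintro ⟨τ, hτ, hT, hU⟩
      obtain ⟨g, rfl⟩ := hT.exists_eq_graphOf
      choose H hH using fun k => (hE _ _ (pos_add_single hv k) rfl).1 τ
        (by rw [hτ]; simp [sum_add_distrib])
      have hu := (hE _ v hv rfl).2
      refine ⟨τ, H i, hH i, congrArg graphOf
        (eq_of_forall_eq_some hu hH (isTope_graphOf.1 hT).2.1 fun x j hx => ?_)⟩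
      obtain ⟨M, hM, σ, hσ, hd, hxM⟩ := hU (x, j) (mem_graphOf.2 hx)
      obtain ⟨ρ, f, hf, rfl⟩ := (h𝓝 M).1 hM
      rw [leftDeg_graphOf_eq_charVec, hf.dom_eq] at hd
      subst hd
      have hc := hf.sum_eq
      obtain ⟨y, hy⟩ := card_pos.1 (show 0 < #(τ \ ρ) by
        rw [card_sdiff_of_subset hσ]; omega)
      rw [mem_sdiff] at hy
      have : ρ = τ.erase y := eq_of_subset_of_card_le
        (fun z hz => mem_erase.2 ⟨by rintro rfl; exact hy.2 hz, hσ hz⟩)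
        (by rw [card_erase_of_mem hy.1]; omega)
      subst this
      exact eq_some_of_goodTope_erase hu hH hf hy.1 (mem_graphOf.1 hxM)
    · rintro ⟨τ, g, hg, rfl⟩
      have hc := hg.sum_eq
      refine ⟨τ, by rw [← hc]; simp [sum_add_distrib],
        isTope_graphOf.2 ⟨pos_add_single hv i, hg.card_fib, hg.dom_eq⟩, ?_⟩
      rintro ⟨x, j⟩ hx
      -- The fibre over `i` has at least two elements, so one other than `x` can be deleted to reach
      -- a tope of type `v` through the given edge.
      obtain ⟨y, hy, hyx⟩ := exists_mem_ne (show 1 < #(fib g i) by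
        rw [hg.card_fib]; have := hv i; simp; omega) x
      have hd := hg.del (mem_fib.1 hy)
      refine ⟨graphOf (del g y), (h𝓝 _).2 ⟨_, _, hd, rfl⟩, τ.erase y, erase_subset _ _,
        leftDeg_graphOf_eq_charVec.2 hd.dom_eq, ?_⟩
      rw [mem_graphOf] at hx ⊢
      exact del_eq_some.2 ⟨hyx.symm, hx⟩

lemma exists_iteratedAmalgamation (𝓜 : Set (BipGraph n d)) (hv : ∀ i, 0 < v i) :
    ∃ 𝓝, IteratedAmalgamation 𝓜 v 𝓝 := by
  obtain ⟨k, hk⟩ : ∃ k, ∑ i, v i = k := ⟨_, rfl⟩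
  induction k generalizing v with
  | zero =>
    have : ∀ i : Fin d, False := fun i => by
      have h1 := single_le_sum (f := v) (fun i _ => Nat.zero_le _) (mem_univ i)
      have h2 := hv i
      omega
    exact ⟨𝓜, (funext fun i => (this i).elim : (1 : Fin d → ℕ) = v) ▸ .base⟩
  | succ k ih =>
    rcases Nat.lt_or_ge (Fintype.card (Fin d)) (∑ i, v i) with h | h
    · obtain ⟨u, r, rfl, hu⟩ := exists_eq_add_single hv h
      obtain ⟨𝓝, h𝓝⟩ := ih hu (by simp [sum_add_distrib] at hk; exact hk)
      exact ⟨_, .step u 𝓝 r h𝓝⟩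
    · have hge : ∑ _i : Fin d, 1 ≤ ∑ i, v i := sum_le_sum fun i _ => hv i
      have : v = 1 := eq_one_of_sum_eq_card hv (le_antisymm h (by simpa using hge))
      subst this
      exact ⟨𝓜, .base⟩

lemma IsLinkageMatchingField.mem_maximalTopes (h : IsLinkageMatchingField 𝓜) :
    G ∈ maximalTopes 𝓜 ↔
      ∃ v f, (∀ i, 0 < v i) ∧ GoodTope (fieldOf 𝓜) v univ f ∧ G = graphOf f := by
  constructor
  · rintro ⟨v, 𝓝, hI, hv, hG⟩
    obtain ⟨hpos, h𝓝⟩ := h.iteratedAmalgamation hI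
    obtain ⟨σ, f, hf, rfl⟩ := (h𝓝 G).1 hG
    have : σ = univ := by
      rw [← card_eq_iff_eq_univ, ← hf.sum_eq, hv, Fintype.card_fin]
    subst this
    exact ⟨v, f, hpos, hf, rfl⟩
  · rintro ⟨v, f, hpos, hf, rfl⟩
    obtain ⟨𝓝, hI⟩ := exists_iteratedAmalgamation 𝓜 hpos
    refine ⟨v, 𝓝, hI, ?_, ((h.iteratedAmalgamation hI).2 _).2 ⟨_, f, hf, rfl⟩⟩
    rw [hf.sum_eq]; simp

lemma sum_sub_one (hv : ∀ i, 0 < v i) : ∑ i, (v i - 1) + d = ∑ i, v i := by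
  have : ∑ i : Fin d, (v i - 1 + 1) = ∑ i, v i :=
    sum_congr rfl fun i _ => by have := hv i; omega
  rw [← this, sum_add_distrib]; simp

/-- The maximal topes of a linkage matching field form a tope arrangement. -/
theorem IsLinkageMatchingField.isTopeArrangement (h : IsLinkageMatchingField 𝓜) (hdn : d ≤ n) :
    IsTopeArrangement (maximalTopes 𝓜) := by
  have hE := h.linkageField.exAt_and_uniqAt
  refine ⟨?_, ?_, ?_, ?_, ?_⟩
  · intro T hT
    obtain ⟨v, f, hv, hf, rfl⟩ := h.mem_maximalTopes.1 hT
    exact ⟨v, univ, isTope_graphOf.2 ⟨hv, hf.card_fib, hf.dom_eq⟩⟩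
  · intro T hT T' hT'
    obtain ⟨v, f, hv, hf, rfl⟩ := h.mem_maximalTopes.1 hT
    obtain ⟨v', f', hv', hf', rfl⟩ := h.mem_maximalTopes.1 hT'
    exact compatible_of_not_cyclic (h.linkageField.not_cyclic hv hv' hf hf')
  · intro T hT
    obtain ⟨v, f, hv, hf, rfl⟩ := h.mem_maximalTopes.1 hT
    simp only [simplexPoints, Set.mem_ofPred_eq, rightDeg_graphOf, hf.card_fib]
    have h1 := sum_sub_one hv
    have h2 := hf.sum_eq
    simp at h2
    omega
  · intro T hT T' hT' hTT
    obtain ⟨v, f, hv, hf, rfl⟩ := h.mem_maximalTopes.1 hT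
    obtain ⟨v', f', hv', hf', rfl⟩ := h.mem_maximalTopes.1 hT'
    have : v = v' := funext fun i => by
      have h1 := congrFun hTT i
      simp only [rightDeg_graphOf, hf.card_fib, hf'.card_fib] at h1
      have := hv i
      have := hv' i
      omega
    subst this
    rw [(hE _ v hv rfl).2 _ _ _ hf hf']
  · intro w hw
    simp only [simplexPoints, Set.mem_ofPred_eq] at hw
    obtain ⟨f, hf⟩ := (hE _ (w + 1) (by simp) rfl).1 univ (by
      simp [sum_add_distrib, hw]; omega)
    exact ⟨graphOf f, h.mem_maximalTopes.2 ⟨w + 1, f, by simp, hf, rfl⟩, by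
      ext i; simp [rightDeg_graphOf, hf.card_fib]⟩

/-! ### From tope arrangements back to matching fields. -/

section Arrangement

variable (h : IsTopeArrangement 𝓣) (hdn : d ≤ n)
include h hdn

lemma IsTopeArrangement.exists_eq_graphOf (hT : T ∈ 𝓣) :
    ∃ f, T = graphOf f ∧ dom f = univ ∧ ∀ i, 0 < #(fib f i) := by
  obtain ⟨v, σ, hσ⟩ := h.1 T hT
  obtain ⟨f, rfl⟩ := hσ.exists_eq_graphOf
  obtain ⟨hv, hf, hd⟩ := isTope_graphOf.1 hσ
  refine ⟨f, rfl, ?_, fun i => by rw [hf]; exact hv i⟩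
  have h1 := h.2.2.1 hT
  simp only [simplexPoints, Set.mem_ofPred_eq, rightDeg_graphOf, hf] at h1
  have h2 := sum_sub_one hv
  have h3 := sum_card_fib f
  simp only [hf] at h3
  rw [← card_eq_iff_eq_univ, Fintype.card_fin]
  omega

lemma IsTopeArrangement.exists_type (hv : ∀ i, 0 < v i) (hn : ∑ i, v i = n) :
    ∃ f, graphOf f ∈ 𝓣 ∧ ∀ i, #(fib f i) = v i := by
  obtain ⟨T, hT, hw⟩ := h.2.2.2.2 (show (fun i => v i - 1) ∈ simplexPoints (n - d) d by
    have := sum_sub_one hv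
    simp only [simplexPoints, Set.mem_ofPred_eq]; omega)
  obtain ⟨f, rfl, -, hf⟩ := h.exists_eq_graphOf hdn hT
  refine ⟨f, hT, fun i => ?_⟩
  have h1 := congrFun hw i
  simp only [rightDeg_graphOf] at h1
  have := hf i
  have := hv i
  omega

omit hdn in
lemma IsTopeArrangement.not_cyclic (hf : graphOf f ∈ 𝓣) (hg : graphOf g ∈ 𝓣) : ¬ Cyclic f g :=
  not_cyclic_of_compatible (h.2.1 _ hf _ hg)

omit h hdn in
/-- A node with an excess in the second tope keeps its elements. -/
lemma eq_some_of_not_cyclic {F F' : Fin n → Option (Fin d)} (hd : dom F' = dom F)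
    (hF : ∀ q, #(fib F q) = (v + Pi.single i 1 : Fin d → ℕ) q)
    (hF' : ∀ q, #(fib F' q) = (v + Pi.single j 1 : Fin d → ℕ) q)
    (hc : ¬ Cyclic F F') (hx : F x = some j) : F' x = some j := by
  have hdom : ∀ y q, F y = some q → ∃ q', F' y = some q' := fun y q hy =>
    Option.ne_none_iff_exists'.1 (mem_dom.1 (hd ▸ mem_dom.2 (by simp [hy])))
  by_contra hne
  obtain ⟨k, hk⟩ := hdom x j hx
  have hkj : k ≠ j := by rintro rfl; exact hne hk
  obtain ⟨I, hI, hcI⟩ := exists_circulating (F := F) (F' := F') (fun _ => True)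
    ⟨x, trivial, j, k, hx, hk, hkj⟩ (by
    intro y _ p q hp hq hqp
    by_cases hqj : q = j
    · subst hqj
      exact ⟨x, trivial, k, hx, hk, hkj⟩
    · obtain ⟨y', hy', hy''⟩ := exists_leaving (Subset.refl (fib F q)) hq
        (by rw [hp]; exact fun h => hqp (Option.some.inj h).symm) (by
          rw [hF, hF']; simp [hqj])
      rw [mem_fib] at hy'
      obtain ⟨q', hq'⟩ := hdom y' q hy'
      exact ⟨y', trivial, q', hy', hq', fun h => hy'' (h ▸ hq')⟩)
  exact hc ⟨I, hI, fun i hi => (hcI i hi).imp fun _ h => h.2⟩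

/-- Add `x ∉ σ` and take topes of types `v + e_i` there. If the first one puts `x` over `j`,
acyclicity keeps `x` over `j` in the tope with excess at `j`, where deleting `x` leaves type `v`. -/
lemma IsTopeArrangement.exists_restr_type (hd : 0 < d) (hv : ∀ i, 0 < v i)
    (hσ : ∑ i, v i = #σ) : ∃ f, graphOf f ∈ 𝓣 ∧ ∀ i, #(fib (restr f σ) i) = v i := by
  obtain ⟨m, hm⟩ : ∃ m, #σ + m = n :=
    ⟨n - #σ, by have := card_le_univ σ; simp at this; omega⟩
  induction m generalizing σ v with
  | zero =>
    have : σ = univ := by rw [← card_eq_iff_eq_univ, Fintype.card_fin]; omega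
    subst this
    obtain ⟨f, hf, hfv⟩ := h.exists_type hdn hv (by simpa using hσ)
    exact ⟨f, hf, by simpa [restr_univ] using hfv⟩
  | succ m ih =>
    obtain ⟨x, hx⟩ : ∃ x, x ∉ σ := by
      by_contra! hcon
      have : σ = univ := eq_univ_of_forall hcon
      subst this
      simp at hm
    have hc : #(insert x σ) = #σ + 1 := card_insert_of_notMem hx
    choose F hF𝓣 hF using fun i => ih (v := v + Pi.single i 1) (σ := insert x σ)
      (pos_add_single hv i) (by rw [hc, ← hσ]; simp [sum_add_distrib]) (by omega)
    have hdomF : ∀ i, dom (F i) = univ := fun i => by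
      obtain ⟨f, hf, hd, -⟩ := h.exists_eq_graphOf hdn (hF𝓣 i)
      rw [graphOf_injective hf, hd]
    have hdom : ∀ i, dom (restr (F i) (insert x σ)) = insert x σ := fun i =>
      dom_restr (by rw [hdomF]; exact subset_univ _)
    obtain ⟨j, hj⟩ : ∃ j, F j x = some j := by
      obtain ⟨j, hj⟩ := Option.ne_none_iff_exists'.1
        (mem_dom.1 (hdomF ⟨0, hd⟩ ▸ mem_univ x : x ∈ dom (F ⟨0, hd⟩)))
      exact ⟨j, sub_restr _ _ (eq_some_of_not_cyclic ((hdom j).trans (hdom _).symm)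
        (hF ⟨0, hd⟩) (hF j)
        (fun hc => h.not_cyclic (hF𝓣 _) (hF𝓣 j) (hc.mono sub_restr sub_restr))
        (restr_eq_some.2 ⟨mem_insert_self _ _, hj⟩))⟩
    refine ⟨F j, hF𝓣 j, fun i => ?_⟩
    have e : fib (restr (F j) σ) i = (fib (restr (F j) (insert x σ)) i).erase x := by
      ext y
      simp only [mem_fib, restr_eq_some, mem_erase, mem_insert]
      constructor
      · rintro ⟨hy, hyi⟩
        exact ⟨by rintro rfl; exact hx hy, Or.inr hy, hyi⟩
      · rintro ⟨hne, hy, hyi⟩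
        exact ⟨hy.resolve_left hne, hyi⟩
    rw [e]
    by_cases hij : i = j
    · subst hij
      rw [card_erase_of_mem (by simp [restr_eq_some, hj]), hF]; simp
    · rw [erase_eq_of_notMem, hF]
      · simp [hij]
      · rw [mem_fib, restr_eq_some, hj]
        exact fun h => hij (Option.some.inj h.2).symm

lemma IsTopeArrangement.mem_maximalMatchings : P ∈ maximalMatchings 𝓣 ↔
    ∃ f g, graphOf f ∈ 𝓣 ∧ P = graphOf g ∧ Sub g f ∧ IsMatch g := by
  constructor
  · rintro ⟨T, hT, hP⟩
    obtain ⟨f, rfl, -, hf⟩ := h.exists_eq_graphOf hdn hT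
    obtain ⟨g, hg⟩ := (maximal_iff hf).1 hP
    exact ⟨f, g, hT, hg⟩
  · rintro ⟨f, g, hf, hg⟩
    obtain ⟨f', hf', -, hpos⟩ := h.exists_eq_graphOf hdn hf
    rw [← graphOf_injective hf'] at hpos
    exact ⟨_, hf, (maximal_iff hpos).2 ⟨g, hg⟩⟩

/-- The maximal matchings of a tope arrangement form a linkage matching field. -/
theorem IsTopeArrangement.isLinkageMatchingField (hd : 0 < d) :
    IsLinkageMatchingField (maximalMatchings 𝓣) := by
  refine ⟨⟨by simp, by simpa using hdn, ?_, ?_⟩, ?_⟩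
  · intro G hG
    obtain ⟨f, g, hf, rfl, hgf, hg⟩ := (h.mem_maximalMatchings hdn).1 hG
    refine ⟨dom g, ?_, isTope_graphOf.2 ⟨by simp, hg, rfl⟩⟩
    rw [← sum_card_fib]; exact sum_congr rfl fun i _ => hg i
  · intro σ hσ
    obtain ⟨f, hf, hm⟩ := h.exists_restr_type hdn (v := 1) hd (by simp) hσ.symm
    obtain ⟨f', hf', hdom, -⟩ := h.exists_eq_graphOf hdn hf
    rw [← graphOf_injective hf'] at hdom
    have hdσ : dom (restr f σ) = σ := dom_restr (by rw [hdom]; exact subset_univ _)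
    refine ⟨graphOf (restr f σ), ⟨(h.mem_maximalMatchings hdn).2
      ⟨f, _, hf, rfl, sub_restr, hm⟩, isTope_graphOf.2 ⟨by simp, hm, hdσ⟩⟩, ?_⟩
    rintro G ⟨hG, hT⟩
    obtain ⟨f₂, g, hf₂, rfl, hgf, hg⟩ := (h.mem_maximalMatchings hdn).1 hG
    have key : ∀ k : Fin n → Option (Fin d), IsMatch k → dom k = σ →
        IsPerfectMatchingOn σ univ (graphOf k) := by
      rintro k hk rfl
      refine ⟨fun e he => ⟨?_, mem_univ _⟩, fun x hx => ?_, fun i _ => ?_⟩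
      · rw [mem_dom, mem_graphOf.1 he]; simp
      · rw [leftDeg_graphOf, charVec, if_pos hx]
      · rw [rightDeg_graphOf, hk i]
    exact h.2.1 _ hf₂ _ hf σ univ _ _ (graphOf_subset.2 hgf) (graphOf_subset.2 sub_restr)
      (key g hg (isTope_graphOf.1 hT).2.2) (key _ hm hdσ)
  · intro r τ hτ
    obtain ⟨f, hf, hm⟩ := h.exists_restr_type hdn (v := 1 + Pi.single r 1) (σ := τ) hd
      (pos_add_single (by simp) r) (by simp [sum_add_distrib, hτ])
    obtain ⟨f', hf', hdom, -⟩ := h.exists_eq_graphOf hdn hf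
    rw [← graphOf_injective hf'] at hdom
    have hdσ : ∀ σ, dom (restr f σ) = σ := fun σ =>
      dom_restr (by rw [hdom]; exact subset_univ _)
    obtain ⟨a, ha, b, hb, hab⟩ := one_lt_card.1 (show 1 < #(fib (restr f τ) r) by
      rw [hm]; simp)
    have hdel : ∀ c, restr f (τ.erase c) = del (restr f τ) c := by
      intro c
      ext x i
      rw [restr_eq_some, del_eq_some, restr_eq_some, mem_erase, and_assoc]
    -- With the full set as field goodness is void; only the degree count of `GoodTope.del` is
    -- wanted.
    have hgood : GoodTope Set.univ (1 + Pi.single r 1) τ (restr f τ) :=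
      ⟨hdσ τ, hm, fun _ _ _ => trivial⟩
    rw [mem_fib] at ha hb
    have hmem : ∀ c, restr f τ c = some r →
        graphOf (restr f (τ.erase c)) ∈ maximalMatchings 𝓣 := fun c hc =>
      (h.mem_maximalMatchings hdn).2 ⟨f, _, hf, rfl, sub_restr, by
        rw [hdel]; exact (hgood.del hc).card_fib⟩
    refine ⟨a, hgood.mem_of_eq ha, b, hgood.mem_of_eq hb, hab, _, hmem a ha, _, hmem b hb,
      leftDeg_graphOf_eq_charVec.2 (hdσ _), leftDeg_graphOf_eq_charVec.2 (hdσ _), ?_⟩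
    intro x i hir
    rw [mem_graphOf, mem_graphOf, hdel, hdel, del_eq_some, del_eq_some]
    refine and_congr_left fun hx => ?_
    have hne : ∀ c, restr f τ c = some r → x ≠ c := by
      rintro c hc rfl
      exact hir (Option.some.inj (hx.symm.trans hc))
    exact iff_of_true (hne a ha) (hne b hb)

/-- The maximal topes of the field of maximal matchings are the topes of the arrangement. -/
theorem IsTopeArrangement.maximalTopes_maximalMatchings (hd : 0 < d) :
    maximalTopes (maximalMatchings 𝓣) = 𝓣 := by
  have hL := h.isLinkageMatchingField hdn hd
  have hgood : ∀ f, graphOf f ∈ 𝓣 → Good (fieldOf (maximalMatchings 𝓣)) f := fun f hf g hg hm =>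
    (h.mem_maximalMatchings hdn).2 ⟨f, g, hf, rfl, hg, hm⟩
  ext T
  rw [hL.mem_maximalTopes]
  constructor
  · rintro ⟨v, f, hv, hf, rfl⟩
    obtain ⟨g, hg, hgv⟩ := h.exists_type hdn hv (by rw [hf.sum_eq]; simp)
    obtain ⟨g', hg', hdom, -⟩ := h.exists_eq_graphOf hdn hg
    rw [← graphOf_injective hg'] at hdom
    rwa [(hL.linkageField.exAt_and_uniqAt _ v hv rfl).2 _ _ _ hf ⟨hdom, hgv, hgood g hg⟩]
  · intro hT
    obtain ⟨f, rfl, hdom, hpos⟩ := h.exists_eq_graphOf hdn hT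
    exact ⟨_, f, hpos, ⟨hdom, fun _ => rfl, hgood f hT⟩, rfl⟩

end Arrangement

/-- The maximal matchings of the arrangement of maximal topes are the matchings of the field. -/
theorem IsLinkageMatchingField.maximalMatchings_maximalTopes (h : IsLinkageMatchingField 𝓜)
    (hd : 0 < d) (hdn : d ≤ n) : maximalMatchings (maximalTopes 𝓜) = 𝓜 := by
  have hA := h.isTopeArrangement hdn
  have hL := hA.isLinkageMatchingField hdn hd
  have hsub : maximalMatchings (maximalTopes 𝓜) ⊆ 𝓜 := by
    intro P hP
    obtain ⟨f, g, hf, rfl, hgf, hg⟩ := (hA.mem_maximalMatchings hdn).1 hP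
    obtain ⟨v, f', hv, hf', he⟩ := h.mem_maximalTopes.1 hf
    rw [graphOf_injective he] at hgf
    exact hf'.good g hgf hg
  -- Both sides have exactly one matching on each `d`-set, so inclusion already forces equality.
  refine hsub.antisymm fun P hP => ?_
  obtain ⟨σ, hσ, hT⟩ := h.1.2.2.1 P hP
  obtain ⟨Q, ⟨hQ, hQT⟩, -⟩ := hL.1.2.2.2 σ hσ
  rwa [(h.1.2.2.2 σ hσ).unique ⟨hP, hT⟩ ⟨hsub hQ, hQT⟩]

end Fields
end TopeArr

theorem mainTheorem5 (n d : ℕ) (hd : 0 < d) (hdn : d ≤ n) :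
    (∀ 𝓜 : Set (TopeArr.BipGraph n d), TopeArr.IsLinkageMatchingField 𝓜 →
      TopeArr.IsTopeArrangement (TopeArr.maximalTopes 𝓜)) ∧
    (∀ 𝓣 : Set (TopeArr.BipGraph n d), TopeArr.IsTopeArrangement 𝓣 →
      TopeArr.IsLinkageMatchingField (TopeArr.maximalMatchings 𝓣)) ∧
    (∀ 𝓜 : Set (TopeArr.BipGraph n d), TopeArr.IsLinkageMatchingField 𝓜 →
      TopeArr.maximalMatchings (TopeArr.maximalTopes 𝓜) = 𝓜) ∧
    (∀ 𝓣 : Set (TopeArr.BipGraph n d), TopeArr.IsTopeArrangement 𝓣 →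
      TopeArr.maximalTopes (TopeArr.maximalMatchings 𝓣) = 𝓣) :=
  ⟨fun _ h => h.isTopeArrangement hdn, fun _ h => h.isLinkageMatchingField hdn hd,
    fun _ h => h.maximalMatchings_maximalTopes hd hdn,
    fun _ h => h.maximalTopes_maximalMatchings hdn hd⟩
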